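/- Let $I=[0,1]$. For a set $A\subset\mathbb R$ put $F_A=\{(x,y)\in I^2 : y=ax \text{ for some } a\in A\}$, and for a relation $G\subseteq I^2$ define the one-sided and the two-sided Mahavier product $$I_G^+=\{(x_i)_{i\ge 1}\in I^{\mathbb N} : (x_i,x_{i+1})\in G \text{ for all } i\ge 1\},\qquad I_G=\{(x_i)_{i\in\mathbb Z}\in I^{\mathbb Z} : (x_i,x_{i+1})\in G\text{ for all } i\in\mathbb Z\},$$ with the metrics $D(\mathbf x,\mathbf y)=\sup_{i\ge 1}|x_i-y_i|/2^{i}$ and $D(\mathbf x,\mathbf y)=\sup_{i\in\mathbb Z}|x_i-y_i|/2^{|i|}$ respectively (which induce the product topologies). Let $\sigma_G^+:I_G^+\to I_G^+$ and $\sigma_G:I_G\to I_G$ be the shift maps, $(\sigma\mathbf x)_i=x_{i+1}$. A dendroid is an arcwise connected, hereditarily unicoherent (metric) continuum. A fan is a dendroid with exactly one ramification point $v$ (its top), a ramification point being the common point of the three legs of a simple triod. A fan is smooth if $x_n\to x$ implies that the arcs from $v$ to $x_n$ converge in the Hausdorff metric to the arc from $v$ to $x$. An endpoint of the fan is a point that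 is an endpoint of every arc containing it. A Lelek fan is a smooth fan whose set of endpoints is dense. A continuous map $f:X\to X$ of a compact metric space $(X,d)$ has the specification property if for each $\varepsilon>0$ there is a positive integer $N$ such that for all $n\ge 1$, all $x_1,\dots,x_n\in X$ and all non-negative integers $k_j\le \ell_j$ $(1\le j\le n)$ with $k_{j+1}-\ell_j\ge N$ for $1\le j<n$, there is $y\in X$ with $d(f^j(y),f^j(x_i))\le\varepsilon$ for all $i\in\{1,\dots,n\}$ and all $j\in\{k_i,\dots,\ell_i\}$. **Theorem.** Let $A\subset[1/3,3]$ be a finite set that contains $3$, $1$ and $1/2$, and let $G=F_A$. Then $I_G^+$ and $I_G$ are Lelek fans, the shift maps $\sigma_G^+$ and $\sigma_G$ are continuous, and both $(I_G^+,\sigma_G^+)$ and $(I_G,\sigma_G)$ have the specification property. (This applies in particular to $A=\{1/2,3,1\}$ and to $A=\{1/2,3,1/3,2,1\}$.) -/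

import Mathlib

open Set Filter Topology

noncomputable section

/-! ## Continua, arcs, dendroids and fans -/

section Fans

variable {X : Type*} [TopologicalSpace X]

/-- `A` is an arc (a homeomorphic copy of `[0,1]`) in `X` whose endpoints are `x` and `y`. -/
def IsArcBetween (A : Set X) (x y : X) : Prop :=
  ∃ f : unitInterval → X, IsEmbedding f ∧ range f = A ∧ f 0 = x ∧ f 1 = y

/-- `A` is an arc in `X`. -/
def IsArc (A : Set X) : Prop := ∃ x y, IsArcBetween A x y

/-- `A` is an arc in `X` and `x` is one of its two endpoints. -/
def IsArcEndpoint (A : Set X) (x : X) : Prop := ∃ y, IsArcBetween A x y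

/-- A subcontinuum: a nonempty, compact, connected subset. -/
def IsSubcontinuum (C : Set X) : Prop := IsCompact C ∧ IsConnected C

/-- A continuum `K` is unicoherent if, whenever it is the union of two subcontinua, these
have connected intersection. -/
def IsUnicoherent (K : Set X) : Prop :=
  ∀ A B : Set X, IsSubcontinuum A → IsSubcontinuum B → A ∪ B = K → IsConnected (A ∩ B)

/-- `x` is a ramification point of `X`: it is the common point of the three legs of a simple
triod in `X`. -/
def IsRamificationPoint (x : X) : Prop :=
  ∃ A : Fin 3 → Set X, (∀ i, IsArcEndpoint (A i) x) ∧ ∀ i j, i ≠ j → A i ∩ A j = {x}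

/-- `e` is an endpoint of the dendroid `X`: it is an endpoint of every arc in `X` that
contains it. -/
def IsDendroidEndpoint (e : X) : Prop :=
  ∀ A : Set X, IsArc A → e ∈ A → IsArcEndpoint A e

/-- `A` is the arc in `X` from `v` to `x`, understood as `{v}` when `x = v`. -/
def IsArcOrPoint (A : Set X) (v x : X) : Prop :=
  (v ≠ x ∧ IsArcBetween A v x) ∨ (v = x ∧ A = {v})

end Fans

/-- A dendroid: an arcwise connected and hereditarily unicoherent (metric) continuum. -/
structure IsDendroid (X : Type*) [MetricSpace X] : Prop where
  compact : CompactSpace X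
  connected : ConnectedSpace X
  arcwise_connected : ∀ x y : X, x ≠ y → ∃ A : Set X, IsArcBetween A x y
  hereditarily_unicoherent : ∀ K : Set X, IsSubcontinuum K → IsUnicoherent K

/-- A fan with top `v`: a dendroid whose one and only ramification point is `v`. -/
structure IsFanWithTop (X : Type*) [MetricSpace X] (v : X) : Prop where
  dendroid : IsDendroid X
  ramification_iff : ∀ x : X, IsRamificationPoint x ↔ x = v

/-- A fan with top `v` is smooth if, whenever `u n → x`, the arcs from `v` to `u n` converge,
in the Hausdorff metric, to the arc from `v` to `x`. -/
structure IsSmoothFanWithTop (X : Type*) [MetricSpace X] (v : X) : Prop where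
  fan : IsFanWithTop X v
  smooth : ∀ (x : X) (u : ℕ → X), Tendsto u atTop (𝓝 x) →
    ∀ (A : ℕ → Set X) (B : Set X), (∀ n, IsArcOrPoint (A n) v (u n)) → IsArcOrPoint B v x →
      Tendsto (fun n => Metric.hausdorffDist (A n) B) atTop (𝓝 0)

/-- A Lelek fan: a smooth fan whose set of endpoints is dense. -/
def IsLelekFan (X : Type*) [MetricSpace X] : Prop :=
  ∃ v : X, IsSmoothFanWithTop X v ∧ Dense {e : X | IsDendroidEndpoint e}

/-! ## The specification property -/

/-- The data of an `n`-specification: orbit segments `f^[k j, l j] (x j)` with `k j ≤ l j`,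
for `j` in an index set of `n ≥ 1` elements. -/
structure Specification (X : Type*) where
  n : ℕ
  n_pos : 0 < n
  k : Fin n → ℕ
  l : Fin n → ℕ
  k_le_l : ∀ j, k j ≤ l j
  x : Fin n → X

/-- Consecutive orbit segments satisfy `k (j + 1) - l j ≥ N`. -/
def Specification.IsSpaced {X : Type*} (S : Specification X) (N : ℕ) : Prop :=
  ∀ (j : ℕ) (hj : j + 1 < S.n), S.l ⟨j, Nat.lt_of_succ_lt hj⟩ + N ≤ S.k ⟨j + 1, hj⟩

/-- `S` is `ε`-traced in `(X, f)` by `y`. -/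
def Specification.IsTracedBy {X : Type*} [MetricSpace X] (S : Specification X) (f : X → X)
    (ε : ℝ) (y : X) : Prop :=
  ∀ i : Fin S.n, ∀ j : ℕ, S.k i ≤ j → j ≤ S.l i → dist (f^[j] y) (f^[j] (S.x i)) ≤ ε

/-- The specification property of `(X, f)`. -/
def HasSpecificationProperty {X : Type*} [MetricSpace X] (f : X → X) : Prop :=
  ∀ ε : ℝ, 0 < ε → ∃ N : ℕ, 0 < N ∧
    ∀ S : Specification X, S.IsSpaced N → ∃ y : X, S.IsTracedBy f ε y

/-! ## The metric `D (x, y) = sup_i |x i - y i| / 2 ^ (w i)` on sequences in `[0,1]` -/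

section WeightedMetric

variable {ι : Type*}

/-- The supremum of `|x i - y i| / 2 ^ (w i)` over all indices `i`. -/
def weightedDist (w : ι → ℕ) (x y : ι → unitInterval) : ℝ :=
  ⨆ i, |(x i : ℝ) - (y i : ℝ)| / 2 ^ w i

theorem weightedDist_term_le (w : ι → ℕ) (x y : ι → unitInterval) (i : ι) :
    |(x i : ℝ) - (y i : ℝ)| / 2 ^ w i ≤ 1 / 2 ^ w i := by
  have h : |(x i : ℝ) - (y i : ℝ)| ≤ 1 := by
    rw [abs_le]
    constructor <;> linarith [(x i).2.1, (x i).2.2, (y i).2.1, (y i).2.2]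
  gcongr

theorem weightedDist_bddAbove (w : ι → ℕ) (x y : ι → unitInterval) :
    BddAbove (range fun i => |(x i : ℝ) - (y i : ℝ)| / 2 ^ w i) := by
  refine ⟨1, ?_⟩
  rintro _ ⟨i, rfl⟩
  refine (weightedDist_term_le w x y i).trans ?_
  rw [div_le_one (by positivity)]
  exact one_le_pow₀ (by norm_num)

theorem le_weightedDist (w : ι → ℕ) (x y : ι → unitInterval) (i : ι) :
    |(x i : ℝ) - (y i : ℝ)| / 2 ^ w i ≤ weightedDist w x y :=
  le_ciSup (weightedDist_bddAbove w x y) i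

theorem weightedDist_nonneg (w : ι → ℕ) (x y : ι → unitInterval) :
    0 ≤ weightedDist w x y :=
  Real.iSup_nonneg fun i => by positivity

theorem weightedDist_triangle (w : ι → ℕ) (x y z : ι → unitInterval) :
    weightedDist w x z ≤ weightedDist w x y + weightedDist w y z := by
  refine Real.iSup_le (fun i => ?_)
    (add_nonneg (weightedDist_nonneg w x y) (weightedDist_nonneg w y z))
  refine le_trans ?_ (add_le_add (le_weightedDist w x y i) (le_weightedDist w y z i))
  rw [← add_div]
  gcongr
  exact abs_sub_le _ _ _

theorem eq_of_weightedDist_eq_zero (w : ι → ℕ) (x y : ι → unitInterval)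
    (h : weightedDist w x y = 0) : x = y := by
  funext i
  have h1 := le_weightedDist w x y i
  rw [h, div_le_iff₀ (by positivity), zero_mul] at h1
  exact Subtype.ext (sub_eq_zero.mp (abs_nonpos_iff.mp h1))

theorem isOpen_iff_weightedDist (w : ι → ℕ) (hw : ∀ n, {i | w i ≤ n}.Finite)
    (s : Set (ι → unitInterval)) :
    IsOpen s ↔ ∀ x ∈ s, ∃ ε > 0, ∀ y, weightedDist w x y < ε → y ∈ s := by
  constructor
  · intro hs x hx
    obtain ⟨F, u, hu, hsub⟩ := isOpen_pi_iff.mp hs x hx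
    have key : ∀ᶠ ε : ℝ in 𝓝[>] 0, ∀ i ∈ F,
        ∀ t : unitInterval, |(x i : ℝ) - (t : ℝ)| / 2 ^ w i < ε → t ∈ u i := by
      rw [Filter.eventually_all_finset]
      intro i hi
      obtain ⟨δ, hδ, hball⟩ := Metric.isOpen_iff.mp (hu i hi).1 (x i) (hu i hi).2
      have hpos : (0 : ℝ) < δ / 2 ^ w i := by positivity
      filter_upwards [Ioo_mem_nhdsGT hpos] with ε hε t ht
      apply hball
      rw [Metric.mem_ball, dist_comm, Subtype.dist_eq, Real.dist_eq]
      have := ht.trans hε.2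
      rwa [div_lt_div_iff_of_pos_right (by positivity)] at this
    obtain ⟨ε, hε, hpos⟩ := (key.and self_mem_nhdsWithin).exists
    refine ⟨ε, hpos, fun y hy => hsub fun i hi => ?_⟩
    exact hε i hi (y i) ((le_weightedDist w x y i).trans_lt hy)
  · intro h
    rw [isOpen_iff_mem_nhds]
    intro x hx
    obtain ⟨ε, hε, hsub⟩ := h x hx
    obtain ⟨n, hn⟩ := exists_pow_lt_of_lt_one (half_pos hε) (by norm_num : (1 / 2 : ℝ) < 1)
    have key : ∀ᶠ y in 𝓝 x, ∀ i ∈ {i | w i ≤ n}, |(x i : ℝ) - (y i : ℝ)| < ε / 2 := by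
      rw [Filter.eventually_all_finite (hw n)]
      intro i _
      have hc : Continuous fun y : ι → unitInterval => |(x i : ℝ) - (y i : ℝ)| := by fun_prop
      refine hc.continuousAt.eventually_lt continuousAt_const ?_
      simpa using hε
    filter_upwards [key] with y hy
    apply hsub
    refine lt_of_le_of_lt (Real.iSup_le (fun i => ?_) (half_pos hε).le) (half_lt_self hε)
    by_cases hi : w i ≤ n
    · exact (div_le_self (abs_nonneg _) (one_le_pow₀ (by norm_num))).trans (hy i hi).le
    · refine (weightedDist_term_le w x y i).trans (le_trans ?_ hn.le)
      rw [one_div_pow]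
      push Not at hi
      gcongr
      norm_num

/-- `weightedDist` as a metric on the product; its topology is the product topology. -/
abbrev weightedMetricSpace (w : ι → ℕ) (hw : ∀ n, {i | w i ≤ n}.Finite) :
    MetricSpace (ι → unitInterval) :=
  MetricSpace.ofDistTopology (weightedDist w)
    (fun x => by simp [weightedDist])
    (fun x y => by simp only [weightedDist, abs_sub_comm])
    (weightedDist_triangle w)
    (isOpen_iff_weightedDist w hw)
    (eq_of_weightedDist_eq_zero w)

end WeightedMetric

/-! ## Mahavier products of relations on `I = [0,1]` and their shift maps -/

/-- The one-sided Mahavier product: sequences `x 0, x 1, …` with `(x i, x (i+1)) ∈ G`. The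
entry `x i` is the coordinate number `i + 1` of the sequence. -/
@[ext]
structure OneSidedProduct (G : Set (unitInterval × unitInterval)) where
  coord : ℕ → unitInterval
  rel : ∀ i, (coord i, coord (i + 1)) ∈ G

/-- The two-sided Mahavier product: bi-infinite sequences with `(x i, x (i+1)) ∈ G`. -/
@[ext]
structure TwoSidedProduct (G : Set (unitInterval × unitInterval)) where
  coord : ℤ → unitInterval
  rel : ∀ i, (coord i, coord (i + 1)) ∈ G

theorem finite_succ_le (n : ℕ) : {i : ℕ | i + 1 ≤ n}.Finite :=
  (Set.finite_Iic n).subset fun i (hi : i + 1 ≤ n) => Set.mem_Iic.mpr (by omega)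

theorem finite_natAbs_le (n : ℕ) : {i : ℤ | i.natAbs ≤ n}.Finite :=
  (Set.finite_Icc (-(n : ℤ)) n).subset fun i (hi : i.natAbs ≤ n) =>
    Set.mem_Icc.mpr (by omega)

/-- The one-sided product, as a subspace of the product space, with the metric
`sup {|x_i - y_i| / 2 ^ i : i ≥ 1}` (coordinates numbered from `1`). -/
instance (G : Set (unitInterval × unitInterval)) : MetricSpace (OneSidedProduct G) :=
  MetricSpace.induced OneSidedProduct.coord (fun _ _ h => OneSidedProduct.ext h)
    (weightedMetricSpace (fun i : ℕ => i + 1) finite_succ_le)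

/-- The two-sided product, as a subspace of the product space, with the metric
`sup {|x_i - y_i| / 2 ^ |i| : i ∈ ℤ}`. -/
instance (G : Set (unitInterval × unitInterval)) : MetricSpace (TwoSidedProduct G) :=
  MetricSpace.induced TwoSidedProduct.coord (fun _ _ h => TwoSidedProduct.ext h)
    (weightedMetricSpace Int.natAbs finite_natAbs_le)

/-- The one-sided shift: `(x_1, x_2, …) ↦ (x_2, x_3, …)`. -/
def oneSidedShift (G : Set (unitInterval × unitInterval)) (x : OneSidedProduct G) :
    OneSidedProduct G where
  coord i := x.coord (i + 1)
  rel i := x.rel (i + 1)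

/-- The two-sided shift: the coordinate `i` of the image is the coordinate `i + 1` of `x`. -/
def twoSidedShift (G : Set (unitInterval × unitInterval)) (x : TwoSidedProduct G) :
    TwoSidedProduct G where
  coord i := x.coord (i + 1)
  rel i := x.rel (i + 1)

/-! ## The family of relations -/

/-- `F_A`: the union of the line segments `y = a x`, `a ∈ A`, in the unit square. -/
def slopeRelation (A : Set ℝ) : Set (unitInterval × unitInterval) :=
  {p | ∃ a ∈ A, (p.2 : ℝ) = a * (p.1 : ℝ)}

/-- The finite sets of slopes in `[1/3, 3]` that contain `3`, `1` and `1/2`. -/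
def slopeSets : Set (Set ℝ) :=
  {A | A.Finite ∧ 3 ∈ A ∧ 1 ∈ A ∧ 1 / 2 ∈ A ∧ ∀ a ∈ A, 1 / 3 ≤ a ∧ a ≤ 3}

/-- The relations `F_A` with `A` in `slopeSets`. -/
def slopeRelationFamily : Set (Set (unitInterval × unitInterval)) :=
  {G | ∃ A ∈ slopeSets, G = slopeRelation A}

end

/-! ## Arcs and cones over zero-dimensional spaces -/

section Arcs

variable {X : Type*} [TopologicalSpace X]

/-! Since all slopes are positive, a point of either product other than the zero sequence has no
vanishing coordinate. It is determined by one coordinate (its height) and by its sequence of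
quotients of consecutive coordinates (its direction). Multiplication by `t ∈ [0,1]` preserves the
relation, so the product is a union of segments issuing from the zero sequence. As `A` is finite,
directions live in a compact zero-dimensional space, and a connected set that misses the vertex has
a single direction. This controls all subcontinua and gives unicoherence and the position of
ramification points. Smoothness follows because scaling does not increase distances.

A point with some coordinate equal to `1` cannot be scaled up, hence is an endpoint. Density of
endpoints and specification are both control problems for orbits. Since `log 3 / log 2` is
irrational, the numbers `3 ^ p / 2 ^ q` are dense in the positive reals. An orbit can therefore go
from any value `u ≥ δ` to slightly below any `b ≥ δ` by halving, tripling and then waiting with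
slope `1`, in a time bounded by compactness. The small mismatch on arrival is absorbed by scaling
the rest of the orbit by a factor close to `1`. Segments with small ends are first made constant
there, which costs at most `3 * δ` because slopes lie in `[1/3, 3]`. The result is
`exists_isSlopeOrbit_tracing`. For endpoints, the orbit is steered close to `1` and divided by its
maximum.

Orbits are built on all of `ℤ`; `ProductModel` transfers them to both products at once. -/

theorem isArcBetween_range [T2Space X] {f : unitInterval → X} (hf : Continuous f)
    (hinj : Function.Injective f) : IsArcBetween (range f) (f 0) (f 1) :=
  ⟨f, (hf.isClosedEmbedding hinj).isEmbedding, rfl, rfl, rfl⟩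

theorem IsArcBetween.symm {A : Set X} {x y : X} (h : IsArcBetween A x y) : IsArcBetween A y x := by
  obtain ⟨f, hf, rfl, rfl, rfl⟩ := h
  refine ⟨f ∘ unitInterval.symm, hf.comp unitInterval.symmHomeomorph.isEmbedding, ?_, ?_, ?_⟩
  · exact unitInterval.symmHomeomorph.surjective.range_comp f
  · simp
  · simp

theorem IsArcBetween.left_mem {A : Set X} {x y : X} (h : IsArcBetween A x y) : x ∈ A := by
  obtain ⟨f, hf, rfl, rfl, rfl⟩ := h
  exact mem_range_self _

theorem IsArcBetween.right_mem {A : Set X} {x y : X} (h : IsArcBetween A x y) : y ∈ A :=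
  h.symm.left_mem

theorem IsArcBetween.ne {A : Set X} {x y : X} (h : IsArcBetween A x y) : x ≠ y := by
  obtain ⟨f, hf, rfl, rfl, rfl⟩ := h
  exact hf.injective.ne zero_ne_one

theorem IsArcBetween.isSubcontinuum {A : Set X} {x y : X} (h : IsArcBetween A x y) :
    IsSubcontinuum A := by
  obtain ⟨f, hf, rfl, rfl, rfl⟩ := h
  exact ⟨isCompact_range hf.continuous, isConnected_range hf.continuous⟩

/-- An arc is irreducible between its endpoints. -/
theorem IsArcBetween.eq_of_subset {A C : Set X} {x y : X} (h : IsArcBetween A x y)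
    (hC : IsPreconnected C) (hCA : C ⊆ A) (hx : x ∈ C) (hy : y ∈ C) : C = A := by
  obtain ⟨f, hf, rfl, rfl, rfl⟩ := h
  have himg : f '' (f ⁻¹' C) = C := image_preimage_eq_of_subset hCA
  have hpre : IsPreconnected (f ⁻¹' C) := by
    rw [← hf.isInducing.isPreconnected_image, himg]
    exact hC
  have huniv : f ⁻¹' C = univ :=
    eq_univ_of_forall fun t => hpre.ordConnected.out hx hy ⟨t.2.1, t.2.2⟩
  rw [← himg, huniv, image_univ]

end Arcs

/-- A chart presenting a metric space as a cone with vertex `top`, all of whose points but the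
vertex are determined by a direction and a height. -/
structure FanChart (X : Type*) [MetricSpace X] (Δ : Type*) [TopologicalSpace Δ] where
  top : X
  height : X → ℝ
  dir : X → Δ
  scale : unitInterval → X → X
  continuous_height : Continuous height
  height_nonneg : ∀ x, 0 ≤ height x
  height_eq_zero_iff : ∀ x, height x = 0 ↔ x = top
  continuousOn_dir : ContinuousOn dir {top}ᶜ
  ext : ∀ x y, height x = height y → dir x = dir y → x = y
  height_scale : ∀ t x, height (scale t x) = t * height x
  dir_scale : ∀ t x, t ≠ 0 → dir (scale t x) = dir x
  continuous_scale : ∀ x, Continuous fun t => scale t x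
  dist_scale_le : ∀ t x y, dist (scale t x) (scale t y) ≤ dist x y

/-! ### Legs and arcs of a cone -/

namespace FanChart

variable {X : Type*} [MetricSpace X] {Δ : Type*} [TopologicalSpace Δ] (F : FanChart X Δ)

theorem height_top : F.height F.top = 0 := (F.height_eq_zero_iff _).2 rfl

theorem height_pos {x : X} (hx : x ≠ F.top) : 0 < F.height x :=
  (F.height_nonneg x).lt_of_ne fun h => hx ((F.height_eq_zero_iff x).1 h.symm)

theorem ne_top_of_height_pos {x : X} (hx : 0 < F.height x) : x ≠ F.top :=
  fun h => hx.ne' ((F.height_eq_zero_iff x).2 h)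

theorem scale_zero (x : X) : F.scale 0 x = F.top := by
  rw [← F.height_eq_zero_iff, F.height_scale]
  simp

theorem scale_one (x : X) : F.scale 1 x = x :=
  F.ext _ _ (by simp [F.height_scale]) (F.dir_scale 1 x one_ne_zero)

theorem scale_top (t : unitInterval) : F.scale t F.top = F.top := by
  rw [← F.height_eq_zero_iff, F.height_scale, F.height_top, mul_zero]

theorem scale_injective {x : X} (hx : x ≠ F.top) : Function.Injective fun t => F.scale t x := by
  intro s t h
  have h' : F.height (F.scale s x) = F.height (F.scale t x) := congrArg F.height h
  rw [F.height_scale, F.height_scale] at h'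
  exact Subtype.ext (mul_right_cancel₀ (F.height_pos hx).ne' h')

theorem scale_ne_top {x : X} (hx : x ≠ F.top) {t : unitInterval} (ht : t ≠ 0) :
    F.scale t x ≠ F.top := by
  rw [← F.scale_zero x]
  exact (F.scale_injective hx).ne ht

/-- The segment from the vertex to `x`. -/
def leg (x : X) : Set X := range fun t => F.scale t x

theorem self_mem_leg (x : X) : x ∈ F.leg x := ⟨1, F.scale_one x⟩

theorem top_mem_leg (x : X) : F.top ∈ F.leg x := ⟨0, F.scale_zero x⟩

theorem leg_top : F.leg F.top = {F.top} := by
  ext y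
  constructor
  · rintro ⟨t, rfl⟩
    exact F.scale_top t
  · rintro rfl
    exact F.top_mem_leg _

theorem isConnected_leg (x : X) : IsConnected (F.leg x) :=
  isConnected_range (F.continuous_scale x)

theorem height_le_of_mem_leg {x y : X} (h : y ∈ F.leg x) : F.height y ≤ F.height x := by
  obtain ⟨t, rfl⟩ := h
  rw [F.height_scale]
  exact mul_le_of_le_one_left (F.height_nonneg x) t.2.2

theorem dir_eq_of_mem_leg {x y : X} (h : y ∈ F.leg x) (hy : y ≠ F.top) : F.dir y = F.dir x := by
  obtain ⟨t, rfl⟩ := h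
  refine F.dir_scale t x fun ht => hy ?_
  rw [ht]
  exact F.scale_zero x

theorem mem_leg_of_dir_eq {x y : X} (hd : F.dir y = F.dir x) (hh : F.height y ≤ F.height x) :
    y ∈ F.leg x := by
  by_cases hy : y = F.top
  · exact hy ▸ F.top_mem_leg x
  have hy0 := F.height_pos hy
  have hx0 := hy0.trans_le hh
  let t : unitInterval := ⟨F.height y / F.height x, by positivity, (div_le_one hx0).2 hh⟩
  have ht : t ≠ 0 := fun h => (div_pos hy0 hx0).ne' (congrArg Subtype.val h)
  exact ⟨t, F.ext _ _ ((F.height_scale t x).trans (div_mul_cancel₀ _ hx0.ne'))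
    ((F.dir_scale t x ht).trans hd.symm)⟩

theorem mem_leg_or_mem_leg {x y : X} (hd : F.dir x = F.dir y) : x ∈ F.leg y ∨ y ∈ F.leg x :=
  (le_total (F.height x) (F.height y)).imp (F.mem_leg_of_dir_eq hd) (F.mem_leg_of_dir_eq hd.symm)

theorem isArcBetween_leg {x : X} (hx : x ≠ F.top) : IsArcBetween (F.leg x) F.top x := by
  have h := isArcBetween_range (F.continuous_scale x) (F.scale_injective hx)
  rwa [F.scale_zero, F.scale_one] at h

theorem exists_isArcBetween_of_mem_leg {x y : X} (hy : y ∈ F.leg x) (hne : x ≠ y) :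
    ∃ A, IsArcBetween A y x := by
  obtain ⟨t, rfl⟩ := hy
  have hx : x ≠ F.top := by
    rintro rfl
    exact hne (F.scale_top t).symm
  have ht : (t : ℝ) < 1 := lt_of_le_of_ne t.2.2 fun h => hne (by
    rw [show t = 1 from Subtype.ext h]
    exact (F.scale_one x).symm)
  let g : unitInterval → unitInterval := fun s => ⟨t + (1 - t) * s, by
    have := t.2.1; have := s.2.1; have := s.2.2
    constructor <;> nlinarith⟩
  have hg : Continuous g := by fun_prop
  have hinj : Function.Injective g := by
    intro a b h
    have h' : (t : ℝ) + (1 - t) * a = t + (1 - t) * b := congrArg Subtype.val h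
    exact Subtype.ext (mul_left_cancel₀ (sub_pos.2 ht).ne' (add_left_cancel h'))
  have h := isArcBetween_range ((F.continuous_scale x).comp hg) ((F.scale_injective hx).comp hinj)
  have h0 : g 0 = t := Subtype.ext (by simp [g])
  have h1 : g 1 = 1 := Subtype.ext (by simp [g])
  simp only [Function.comp_apply, h0, h1, F.scale_one] at h
  exact ⟨_, h⟩



theorem exists_isArcBetween_of_notMem_leg {x y : X} (hyx : y ∉ F.leg x) (hxy : x ∉ F.leg y) :
    ∃ A, IsArcBetween A x y := by
  have hx : x ≠ F.top := fun h => hxy (h ▸ F.top_mem_leg y)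
  have hy : y ≠ F.top := fun h => hyx (h ▸ F.top_mem_leg x)
  have hd : F.dir x ≠ F.dir y := fun h => (F.mem_leg_or_mem_leg h).elim hxy hyx
  let p : ℝ → unitInterval := projIcc 0 1 zero_le_one
  have hp : Continuous p := continuous_projIcc
  -- Down the leg of `x` to the vertex, then up the leg of `y`. The projection `p` makes each branch
  -- meaningful for all `t`.
  let f : unitInterval → X := fun t =>
    if (t : ℝ) ≤ 1 / 2 then F.scale (p (1 - 2 * t)) x else F.scale (p (2 * t - 1)) y
  have hf : Continuous f := by
    refine Continuous.if_le ((F.continuous_scale x).comp (hp.comp (by fun_prop)))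
      ((F.continuous_scale y).comp (hp.comp (by fun_prop))) (by fun_prop) (by fun_prop) ?_
    intro t ht
    rw [ht, show p (1 - 2 * (1 / 2)) = 0 from projIcc_of_le_left _ (by norm_num),
      show p (2 * (1 / 2) - 1) = 0 from projIcc_of_le_left _ (by norm_num), F.scale_zero,
      F.scale_zero]
  have hcoe : ∀ r : ℝ, 0 ≤ r → r ≤ 1 → (p r : ℝ) = r := fun r h0 h1 =>
    congrArg Subtype.val (projIcc_of_mem zero_le_one (x := r) ⟨h0, h1⟩)
  have hcross : ∀ s t : unitInterval, (s : ℝ) ≤ 1 / 2 → ¬ (t : ℝ) ≤ 1 / 2 → f s ≠ f t := by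
    intro s t hs ht h
    simp only [f, if_pos hs, if_neg ht] at h
    have hpt : p (2 * t - 1) ≠ 0 := fun h0 => by
      have := congrArg Subtype.val h0
      rw [hcoe _ (by linarith) (by linarith [t.2.2])] at this
      simp only [Icc.coe_zero] at this
      linarith
    have hps : p (1 - 2 * s) ≠ 0 := fun h0 => by
      rw [h0, F.scale_zero] at h
      exact F.scale_ne_top hy hpt h.symm
    exact hd (by rw [← F.dir_scale _ x hps, h, F.dir_scale _ y hpt])
  have hinj : Function.Injective f := by
    intro s t h
    by_cases hs : (s : ℝ) ≤ 1 / 2 <;> by_cases ht : (t : ℝ) ≤ 1 / 2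
    · simp only [f, if_pos hs, if_pos ht] at h
      have := congrArg Subtype.val (F.scale_injective hx h)
      rw [hcoe _ (by linarith) (by linarith [s.2.1]), hcoe _ (by linarith) (by linarith [t.2.1])]
        at this
      exact Subtype.ext (by linarith)
    · exact absurd h (hcross s t hs ht)
    · exact absurd h.symm (hcross t s ht hs)
    · simp only [f, if_neg hs, if_neg ht] at h
      have := congrArg Subtype.val (F.scale_injective hy h)
      rw [hcoe _ (by linarith) (by linarith [s.2.2]), hcoe _ (by linarith) (by linarith [t.2.2])]
        at this
      exact Subtype.ext (by linarith)
  have h := isArcBetween_range hf hinj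
  have h0 : f 0 = x := by
    have : p 1 = 1 := projIcc_of_right_le _ le_rfl
    simp [f, this, F.scale_one]
  have h1 : f 1 = y := by
    have : p (2 - 1) = 1 := projIcc_of_right_le _ (by norm_num)
    have h2 : ¬ (1 : ℝ) ≤ 2⁻¹ := by norm_num
    simp [f, this, F.scale_one, h2]
  rw [h0, h1] at h
  exact ⟨_, h⟩

theorem isRamificationPoint_top (e : Fin 3 → X) (he : ∀ i, e i ≠ F.top)
    (hd : Function.Injective fun i => F.dir (e i)) : IsRamificationPoint F.top := by
  refine ⟨fun i => F.leg (e i), fun i => ⟨e i, F.isArcBetween_leg (he i)⟩, fun i j hij => ?_⟩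
  refine Subset.antisymm (fun y hy => ?_) ?_
  · by_contra hne
    exact hd.ne hij ((F.dir_eq_of_mem_leg hy.1 hne).symm.trans (F.dir_eq_of_mem_leg hy.2 hne))
  · rintro _ rfl
    exact ⟨F.top_mem_leg _, F.top_mem_leg _⟩

/-- Points with the same parameter are matched. Smoothness of the fan needs nothing more. -/
theorem hausdorffDist_leg_le (x y : X) :
    Metric.hausdorffDist (F.leg x) (F.leg y) ≤ dist x y := by
  refine Metric.hausdorffDist_le_of_mem_dist dist_nonneg ?_ ?_
  · rintro _ ⟨t, rfl⟩
    exact ⟨F.scale t y, ⟨t, rfl⟩, F.dist_scale_le t x y⟩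
  · rintro _ ⟨t, rfl⟩
    exact ⟨F.scale t x, ⟨t, rfl⟩, (F.dist_scale_le t y x).trans (dist_comm y x).le⟩

/-- Suppose `z` on the leg of `x` is not in `C`. The points of `C` at the height of `z` have
directions in a compact set avoiding `dir z`, so some clopen `D` around `dir z` misses it. The
points of `C` above that height with direction in `D` are then separated from the rest of `C`; they
include `x` but not the vertex, against connectedness. -/
theorem leg_subset_of_top_mem [CompactSpace Δ] [T2Space Δ] [TotallyDisconnectedSpace Δ]
    {C : Set X} (hC : IsSubcontinuum C) (htop : F.top ∈ C) {x : X} (hx : x ∈ C) :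
    F.leg x ⊆ C := by
  rintro _ ⟨t, rfl⟩
  by_contra hz
  change F.scale t x ∉ C at hz
  have ht0 : t ≠ 0 := by
    rintro rfl
    exact hz (by rwa [F.scale_zero])
  have ht1 : t ≠ 1 := by
    rintro rfl
    exact hz (by rwa [F.scale_one])
  have hxt : x ≠ F.top := by
    rintro rfl
    exact hz (by rwa [F.scale_top])
  set z := F.scale t x with hzdef
  have hz0 : 0 < F.height z := F.height_pos (F.scale_ne_top hxt ht0)
  have hzx : F.height z < F.height x := by
    rw [hzdef, F.height_scale]
    exact mul_lt_of_lt_one_left (F.height_pos hxt)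
      (lt_of_le_of_ne t.2.2 fun h => ht1 (Subtype.ext h))
  have hZ : IsCompact (C ∩ F.height ⁻¹' {F.height z}) :=
    hC.1.inter_right (isClosed_singleton.preimage F.continuous_height)
  have hZd : IsClosed (F.dir '' (C ∩ F.height ⁻¹' {F.height z})) := by
    refine (hZ.image_of_continuousOn (F.continuousOn_dir.mono ?_)).isClosed
    rintro y ⟨-, hy⟩
    refine F.ne_top_of_height_pos ?_
    rw [mem_preimage, mem_singleton_iff] at hy
    rwa [hy]
  have hnot : F.dir z ∈ (F.dir '' (C ∩ F.height ⁻¹' {F.height z}))ᶜ := by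
    rintro ⟨y, ⟨hyC, hy⟩, hd⟩
    exact hz (F.ext y z hy hd ▸ hyC)
  obtain ⟨D, hD, hzD, hDsub⟩ := compact_exists_isClopen_in_isOpen hZd.isOpen_compl hnot
  have hop : IsOpen ({F.top}ᶜ : Set X) := isOpen_compl_singleton
  have hU : IsOpen ({F.top}ᶜ ∩ F.dir ⁻¹' D ∩ {y | F.height z < F.height y}) :=
    (F.continuousOn_dir.isOpen_inter_preimage hop hD.isOpen).inter
      (isOpen_lt continuous_const F.continuous_height)
  have hV : IsOpen ({y | F.height y < F.height z} ∪ {F.top}ᶜ ∩ F.dir ⁻¹' Dᶜ) :=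
    (isOpen_lt F.continuous_height continuous_const).union
      (F.continuousOn_dir.isOpen_inter_preimage hop hD.compl.isOpen)
  obtain ⟨y, -, ⟨⟨-, hyD⟩, hyz⟩, hy⟩ := hC.2.isPreconnected _ _ hU hV (fun y hy => by
      rcases lt_trichotomy (F.height y) (F.height z) with h | h | h
      · exact Or.inr (Or.inl h)
      · exact Or.inr (Or.inr ⟨F.ne_top_of_height_pos (h ▸ hz0),
          fun hyD => hDsub hyD ⟨y, ⟨hy, h⟩, rfl⟩⟩)
      · by_cases hyD : F.dir y ∈ D
        · exact Or.inl ⟨⟨F.ne_top_of_height_pos (hz0.trans h), hyD⟩, h⟩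
        · exact Or.inr (Or.inr ⟨F.ne_top_of_height_pos (hz0.trans h), hyD⟩))
    ⟨x, hx, ⟨hxt, show F.dir x ∈ D by rwa [← F.dir_scale t x ht0]⟩, hzx⟩
    ⟨F.top, htop, Or.inl (by simpa [F.height_top] using hz0)⟩
  rcases hy with hy | hy
  · exact lt_asymm (show F.height y < F.height z from hy) hyz
  · exact hy.2 hyD

theorem dir_eq_of_top_notMem [TotallyDisconnectedSpace Δ] {C : Set X} (hC : IsPreconnected C)
    (htop : F.top ∉ C) {x y : X} (hx : x ∈ C) (hy : y ∈ C) : F.dir x = F.dir y :=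
  (hC.image F.dir (F.continuousOn_dir.mono fun _ hz h => htop (h ▸ hz))).subsingleton
    (mem_image_of_mem _ hx) (mem_image_of_mem _ hy)

theorem top_mem_of_notMem_leg [TotallyDisconnectedSpace Δ] {C : Set X}
    (hC : IsSubcontinuum C) {x y : X} (hx : x ∈ C) (hy : y ∈ C) (hxy : x ∉ F.leg y)
    (hyx : y ∉ F.leg x) : F.top ∈ C := by
  by_contra htop
  rcases F.mem_leg_or_mem_leg (F.dir_eq_of_top_notMem hC.2.isPreconnected htop hx hy) with h | h
  · exact hxy h
  · exact hyx h

/-! ### Unicoherence, ramification points, smoothness and endpoints of a cone -/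

variable [CompactSpace Δ] [T2Space Δ] [TotallyDisconnectedSpace Δ]

/-- A subcontinuum through the vertex contains the legs of its points. One that misses the vertex
has a single direction, and the intermediate value theorem for the height applies. -/
theorem mem_of_between {C : Set X} (hC : IsSubcontinuum C) {x y z : X} (hx : x ∈ C) (hy : y ∈ C)
    (hz : z ∈ F.leg x) (hyz : F.height y ≤ F.height z) : z ∈ C := by
  by_cases htop : F.top ∈ C
  · exact F.leg_subset_of_top_mem hC htop hx hz
  obtain ⟨w, hw, hwz⟩ := hC.2.isPreconnected.intermediate_value hy hx
    F.continuous_height.continuousOn ⟨hyz, F.height_le_of_mem_leg hz⟩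
  have hz0 : z ≠ F.top :=
    F.ne_top_of_height_pos ((F.height_pos fun h => htop (h ▸ hy)).trans_le hyz)
  rwa [← F.ext w z hwz ((F.dir_eq_of_top_notMem hC.2.isPreconnected htop hw hx).trans
    (F.dir_eq_of_mem_leg hz hz0).symm)]

/-- Two common points on one leg are joined by the segment between them, which lies in both sets.
Otherwise both sets contain the vertex, hence both legs. -/
theorem isPreconnected_inter (F : FanChart X Δ) {A B : Set X} (hA : IsSubcontinuum A)
    (hB : IsSubcontinuum B) : IsPreconnected (A ∩ B) := by
  have key : ∀ x ∈ A ∩ B, ∀ y ∈ A ∩ B, y ∈ F.leg x →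
      ∃ t ⊆ A ∩ B, x ∈ t ∧ y ∈ t ∧ IsPreconnected t := by
    rintro x hx y hy ⟨t, rfl⟩
    refine ⟨(fun s => F.scale s x) '' Icc t 1, ?_, ⟨1, ⟨t.2.2, le_rfl⟩, F.scale_one x⟩,
      ⟨t, ⟨le_rfl, t.2.2⟩, rfl⟩, isPreconnected_Icc.image _ (F.continuous_scale x).continuousOn⟩
    rintro _ ⟨s, hs, rfl⟩
    have hle : F.height (F.scale t x) ≤ F.height (F.scale s x) := by
      rw [F.height_scale, F.height_scale]
      exact mul_le_mul_of_nonneg_right hs.1 (F.height_nonneg x)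
    exact ⟨F.mem_of_between hA hx.1 hy.1 ⟨s, rfl⟩ hle, F.mem_of_between hB hx.2 hy.2 ⟨s, rfl⟩ hle⟩
  refine isPreconnected_of_forall_pair fun x hx y hy => ?_
  by_cases hyx : y ∈ F.leg x
  · exact key x hx y hy hyx
  by_cases hxy : x ∈ F.leg y
  · obtain ⟨t, h1, h2, h3, h4⟩ := key y hy x hx hxy
    exact ⟨t, h1, h3, h2, h4⟩
  have hAt := F.top_mem_of_notMem_leg hA hx.1 hy.1 hxy hyx
  have hBt := F.top_mem_of_notMem_leg hB hx.2 hy.2 hxy hyx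
  refine ⟨F.leg x ∪ F.leg y, union_subset ?_ ?_, Or.inl (F.self_mem_leg x),
    Or.inr (F.self_mem_leg y), (F.isConnected_leg x).isPreconnected.union F.top
      (F.top_mem_leg x) (F.top_mem_leg y) (F.isConnected_leg y).isPreconnected⟩
  · exact subset_inter (F.leg_subset_of_top_mem hA hAt hx.1) (F.leg_subset_of_top_mem hB hBt hx.2)
  · exact subset_inter (F.leg_subset_of_top_mem hA hAt hy.1) (F.leg_subset_of_top_mem hB hBt hy.2)

theorem isUnicoherent (F : FanChart X Δ) {K : Set X} (hK : IsSubcontinuum K) :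
    IsUnicoherent K := by
  intro A B hA hB hAB
  refine ⟨?_, F.isPreconnected_inter hA hB⟩
  obtain ⟨x, -, hx⟩ := isPreconnected_closed_iff.1 hK.2.isPreconnected A B hA.1.isClosed
    hB.1.isClosed hAB.ge (by
      obtain ⟨a, ha⟩ := hA.2.nonempty
      exact ⟨a, hAB ▸ Or.inl ha, ha⟩) (by
      obtain ⟨b, hb⟩ := hB.2.nonempty
      exact ⟨b, hAB ▸ Or.inr hb, hb⟩)
  exact ⟨x, hx⟩

theorem isDendroid (F : FanChart X Δ) [CompactSpace X] : IsDendroid X where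
  compact := inferInstance
  connected := by
    have : Nonempty X := ⟨F.top⟩
    have h : IsPreconnected (univ : Set X) := isPreconnected_of_forall F.top fun x _ =>
      ⟨F.leg x, subset_univ _, F.top_mem_leg x, F.self_mem_leg x,
        (F.isConnected_leg x).isPreconnected⟩
    exact connectedSpace_iff_univ.2 ⟨univ_nonempty, h⟩
  arcwise_connected x y hxy := by
    by_cases hyx : y ∈ F.leg x
    · exact (F.exists_isArcBetween_of_mem_leg hyx hxy).imp fun A hA => hA.symm
    by_cases hxy' : x ∈ F.leg y
    · exact F.exists_isArcBetween_of_mem_leg hxy' hxy.symm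
    · exact F.exists_isArcBetween_of_notMem_leg hyx hxy'
  hereditarily_unicoherent _ hK := F.isUnicoherent hK

/-- To reach a point `y` that is not above `x` on its leg, a continuum has to leave `x` downwards.
Two such continua thus share a short segment below `x`. -/
theorem exists_forall_scale_mem {C : Set X} (hC : IsSubcontinuum C) {x y : X} (hx : x ∈ C)
    (hy : y ∈ C) (hxy : x ∉ F.leg y) : ∃ s < 1, ∀ t, s ≤ t → F.scale t x ∈ C := by
  by_cases hyx : y ∈ F.leg x
  · obtain ⟨s, rfl⟩ := hyx
    refine ⟨s, lt_of_le_of_ne s.2.2 ?_, fun t hst => F.mem_of_between hC hx hy ⟨t, rfl⟩ ?_⟩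
    · rintro rfl
      apply hxy
      simp only [F.scale_one]
      exact F.self_mem_leg x
    · rw [F.height_scale, F.height_scale]
      exact mul_le_mul_of_nonneg_right hst (F.height_nonneg x)
  · exact ⟨0, zero_lt_one, fun t _ => F.leg_subset_of_top_mem hC
      (F.top_mem_of_notMem_leg hC hx hy hxy hyx) hx ⟨t, rfl⟩⟩

theorem exists_scale_mem_inter {A B : Set X} (hA : IsSubcontinuum A) (hB : IsSubcontinuum B)
    {x y z : X} (hx : x ≠ F.top) (hxA : x ∈ A) (hxB : x ∈ B) (hy : y ∈ A) (hz : z ∈ B)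
    (hxy : x ∉ F.leg y) (hxz : x ∉ F.leg z) : ∃ w ∈ A ∩ B, w ≠ x := by
  obtain ⟨s, hs, hsA⟩ := F.exists_forall_scale_mem hA hxA hy hxy
  obtain ⟨t, ht, htB⟩ := F.exists_forall_scale_mem hB hxB hz hxz
  refine ⟨F.scale (max s t) x, ⟨hsA _ (le_max_left _ _), htB _ (le_max_right _ _)⟩, fun h => ?_⟩
  exact (max_lt hs ht).ne (F.scale_injective hx (h.trans (F.scale_one x).symm))

/-- By pigeonhole, two of the three far ends are both above `x` or both not. If both are above, the
lower one lies on both arcs. If neither is, both arcs contain a short segment below `x`. -/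
theorem eq_top_of_isRamificationPoint {x : X} (h : IsRamificationPoint x) : x = F.top := by
  by_contra hx
  obtain ⟨A, hA, hint⟩ := h
  choose y hy using hA
  have key : ∃ i j : Fin 3, i ≠ j ∧ (x ∈ F.leg (y i) ↔ x ∈ F.leg (y j)) := by
    by_cases h0 : x ∈ F.leg (y 0) <;> by_cases h1 : x ∈ F.leg (y 1) <;>
      by_cases h2 : x ∈ F.leg (y 2)
    all_goals first
      | exact ⟨0, 1, by decide, by tauto⟩
      | exact ⟨0, 2, by decide, by tauto⟩
      | exact ⟨1, 2, by decide, by tauto⟩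
  obtain ⟨i, j, hij, hiff⟩ := key
  have hup : ∀ i j, i ≠ j → x ∈ F.leg (y i) → y i ∈ F.leg (y j) → False := by
    intro i j hij hi hyij
    have hmem : y i ∈ A i ∩ A j := ⟨(hy i).right_mem, F.mem_of_between (hy j).isSubcontinuum
      (hy j).right_mem (hy j).left_mem hyij (F.height_le_of_mem_leg hi)⟩
    rw [hint i j hij] at hmem
    exact (hy i).ne hmem.symm
  by_cases hi : x ∈ F.leg (y i)
  · have hj := hiff.1 hi
    rcases F.mem_leg_or_mem_leg ((F.dir_eq_of_mem_leg hi hx).symm.trans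
      (F.dir_eq_of_mem_leg hj hx)) with h | h
    · exact hup i j hij hi h
    · exact hup j i hij.symm hj h
  · obtain ⟨w, hw, hwx⟩ := F.exists_scale_mem_inter (hy i).isSubcontinuum (hy j).isSubcontinuum hx
      (hy i).left_mem (hy j).left_mem (hy i).right_mem (hy j).right_mem hi
      (fun h => hi (hiff.2 h))
    rw [hint i j hij] at hw
    exact hwx hw

theorem eq_leg_of_isArcOrPoint {A : Set X} {x : X} (h : IsArcOrPoint A F.top x) : A = F.leg x := by
  rcases h with ⟨-, h⟩ | ⟨rfl, h⟩
  · exact (h.eq_of_subset (F.isConnected_leg x).isPreconnected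
      (F.leg_subset_of_top_mem h.isSubcontinuum h.left_mem h.right_mem) (F.top_mem_leg x)
      (F.self_mem_leg x)).symm
  · rw [h, F.leg_top]

theorem isSmoothFanWithTop [CompactSpace X] (e : Fin 3 → X) (he : ∀ i, e i ≠ F.top)
    (hd : Function.Injective fun i => F.dir (e i)) : IsSmoothFanWithTop X F.top where
  fan := ⟨F.isDendroid, fun _ => ⟨F.eq_top_of_isRamificationPoint, fun h =>
    h ▸ F.isRamificationPoint_top e he hd⟩⟩
  smooth x u hu A B hA hB := by
    refine squeeze_zero (fun _ => Metric.hausdorffDist_nonneg) (fun n => ?_)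
      (tendsto_iff_dist_tendsto_zero.1 hu)
    rw [F.eq_leg_of_isArcOrPoint (hA n), F.eq_leg_of_isArcOrPoint hB]
    exact F.hausdorffDist_leg_le _ _

/-- If `e` were interior to an arc, both halves would have to leave `e` downwards, as nothing lies
above it, and would meet again below `e`. -/
theorem isDendroidEndpoint {e : X} (he : e ≠ F.top) (hmax : ∀ y, e ∈ F.leg y → y = e) :
    IsDendroidEndpoint e := by
  intro A hA heA
  obtain ⟨x, y, hxy⟩ := hA
  have hxy' := hxy
  obtain ⟨f, hf, rfl, rfl, rfl⟩ := hxy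
  obtain ⟨c, rfl⟩ := heA
  by_cases h0 : c = 0
  · exact ⟨f 1, h0 ▸ hxy'⟩
  by_cases h1 : c = 1
  · exact ⟨f 0, h1 ▸ hxy'.symm⟩
  have hsub : ∀ a b : unitInterval, a ≤ b → IsSubcontinuum (f '' Icc a b) := fun a b hab =>
    ⟨isCompact_Icc.image hf.continuous, (isConnected_Icc hab).image f hf.continuous.continuousOn⟩
  obtain ⟨w, ⟨⟨s, hs, rfl⟩, ⟨t, ht, hst⟩⟩, hne⟩ := F.exists_scale_mem_inter
    (hsub 0 c c.2.1) (hsub c 1 c.2.2) he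
    ⟨c, ⟨c.2.1, le_rfl⟩, rfl⟩ ⟨c, ⟨le_rfl, c.2.2⟩, rfl⟩ ⟨0, ⟨le_rfl, c.2.1⟩, rfl⟩
    ⟨1, ⟨c.2.2, le_rfl⟩, rfl⟩ (fun h => h0 (hf.injective (hmax _ h)).symm)
    (fun h => h1 (hf.injective (hmax _ h)).symm)
  have := hf.injective hst
  subst this
  exact (hne (congrArg f (le_antisymm hs.2 ht.1))).elim

end FanChart

/-! ## Density of the numbers `3 ^ p / 2 ^ q` -/

/-- A rational value would give `3 ^ d = 2 ^ a` with `a > 0`, against parity. -/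
theorem irrational_log_three_div_log_two : Irrational (Real.log 3 / Real.log 2) := by
  rintro ⟨q, hq⟩
  have h2 : 0 < Real.log 2 := Real.log_pos (by norm_num)
  have h3 : 0 < Real.log 3 := Real.log_pos (by norm_num)
  have hq0 : (0 : ℝ) < q := hq ▸ div_pos h3 h2
  have hnum : 0 < q.num := Rat.num_pos.2 (by exact_mod_cast hq0)
  obtain ⟨a, ha⟩ := Int.eq_ofNat_of_zero_le hnum.le
  have hqa : (q : ℝ) = a / q.den := by
    rw [Rat.cast_def, ha]
    simp
  have hden : (0 : ℝ) < q.den := by exact_mod_cast q.den_pos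
  have hlog : q.den * Real.log 3 = a * Real.log 2 := by
    rw [hqa] at hq
    field_simp at hq
    linarith
  rw [← Real.log_pow, ← Real.log_pow] at hlog
  have hpow : (3 : ℝ) ^ q.den = 2 ^ a :=
    Real.log_injOn_pos (by simp) (by simp) hlog
  have hnat : 3 ^ q.den = 2 ^ a := by exact_mod_cast hpow
  have ha0 : a ≠ 0 := by
    rintro rfl
    simp [ha] at hnum
  have hodd : Odd (3 ^ q.den) := Odd.pow (by decide)
  rw [hnat] at hodd
  exact (Nat.not_even_iff_odd.2 hodd) ((even_two).pow_of_ne_zero ha0)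

theorem exists_three_pow_div_two_pow_mem_Ioo {a b : ℝ} (ha : 0 < a) (hab : a < b) :
    ∃ p q : ℕ, (3 : ℝ) ^ p / 2 ^ q ∈ Ioo a b := by
  have h2 : 0 < Real.log 2 := Real.log_pos (by norm_num)
  have h3 : 0 < Real.log 3 := Real.log_pos (by norm_num)
  have hb : 0 < b := ha.trans hab
  have : Fact (0 < Real.log 2) := ⟨h2⟩
  -- Multiples of `log 3` are dense modulo `log 2`, but the multiple of `log 2` to subtract must be
  -- nonnegative. Lowering the target interval by `k * log 3` makes it negative, which forces `q ≥
  -- 0`; the `k` factors of `3` are restored at the end.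
  obtain ⟨k, hk⟩ := exists_nat_ge (Real.log b / Real.log 3)
  rw [div_le_iff₀ h3] at hk
  have hdense : DenseRange fun n : ℕ => n • (Real.log 3 : AddCircle (Real.log 2)) :=
    denseRange_zsmul_iff_nsmul.1
      (AddCircle.denseRange_zsmul_coe_iff.2 irrational_log_three_div_log_two)
  obtain ⟨p, u, ⟨hu1, hu2⟩, hpu⟩ := hdense.exists_mem_open
    (QuotientAddGroup.isOpenMap_coe (N := AddSubgroup.zmultiples (Real.log 2))
      (Ioo (Real.log a - k * Real.log 3) (Real.log b - k * Real.log 3)) isOpen_Ioo)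
    (Set.Nonempty.image _ (nonempty_Ioo.2 (sub_lt_sub_right (Real.log_lt_log ha hab) _)))
  have hpu' : ((u : ℝ) : AddCircle (Real.log 2)) = ((p • Real.log 3 : ℝ) : AddCircle _) := hpu
  obtain ⟨q, hq⟩ := AddSubgroup.mem_zmultiples_iff.1 (QuotientAddGroup.eq.1 hpu')
  rw [zsmul_eq_mul, nsmul_eq_mul] at hq
  have hq0 : 0 ≤ q := by
    by_contra hneg
    have hq1 : (q : ℝ) < 0 := by exact_mod_cast not_le.1 hneg
    have := mul_neg_of_neg_of_pos hq1 h2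
    have : (0 : ℝ) ≤ p * Real.log 3 := by positivity
    linarith
  lift q to ℕ using hq0
  rw [Int.cast_natCast] at hq
  have hlog : Real.log (3 ^ (p + k) / 2 ^ q) = u + k * Real.log 3 := by
    rw [Real.log_div (by positivity) (by positivity), Real.log_pow, Real.log_pow, hq]
    push_cast
    ring
  refine ⟨p + k, q, ?_, ?_⟩
  · rw [← Real.log_lt_log_iff ha (by positivity), hlog]
    linarith
  · rw [← Real.log_lt_log_iff (by positivity) hb, hlog]
    linarith

/-- A pair `p, q` with strict inequalities at `r` also serves all ratios near `r`, so by compactness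
finitely many pairs suffice. -/
theorem exists_bound_three_pow_div_two_pow {δ η : ℝ} (hδ : 0 < δ) (hη : 0 < η) (hη1 : η < 1) :
    ∃ N : ℕ, ∀ r ∈ Icc δ δ⁻¹, ∃ p q : ℕ, p + q ≤ N ∧ (1 - η) * r ≤ 3 ^ p / 2 ^ q ∧
      (3 : ℝ) ^ p / 2 ^ q ≤ r := by
  refine isCompact_Icc.induction_on (p := fun s => ∃ N : ℕ, ∀ r ∈ s, ∃ p q : ℕ, p + q ≤ N ∧
    (1 - η) * r ≤ 3 ^ p / 2 ^ q ∧ (3 : ℝ) ^ p / 2 ^ q ≤ r) ⟨0, by simp⟩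
    (fun s t hst ⟨N, hN⟩ => ⟨N, fun r hr => hN r (hst hr)⟩) ?_ ?_
  · rintro s t ⟨M, hM⟩ ⟨N, hN⟩
    refine ⟨max M N, fun r hr => ?_⟩
    rcases hr with hr | hr
    · obtain ⟨p, q, h, h'⟩ := hM r hr
      exact ⟨p, q, h.trans (le_max_left _ _), h'⟩
    · obtain ⟨p, q, h, h'⟩ := hN r hr
      exact ⟨p, q, h.trans (le_max_right _ _), h'⟩
  · intro r hr
    have hr0 : 0 < r := hδ.trans_le hr.1
    obtain ⟨p, q, h1, h2⟩ := exists_three_pow_div_two_pow_mem_Ioo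
      (mul_pos (sub_pos.2 hη1) hr0) (show (1 - η) * r < r by nlinarith)
    refine ⟨_, mem_nhdsWithin_of_mem_nhds (inter_mem
      ((continuous_const.mul continuous_id).continuousAt.eventually_lt continuousAt_const h1)
      (Ioi_mem_nhds h2)), p + q, fun s hs => ⟨p, q, le_rfl, ?_, ?_⟩⟩
    · exact le_of_lt hs.1
    · exact le_of_lt hs.2

/-! ## Bi-infinite orbits -/

/-- A bi-infinite sequence in `[0,1]` each of whose terms is a multiple of the previous one by
an element of `A`. -/
structure IsSlopeOrbit (A : Set ℝ) (y : ℤ → ℝ) : Prop where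
  mem_Icc : ∀ p, y p ∈ Icc (0 : ℝ) 1
  step : ∀ p, ∃ a ∈ A, y (p + 1) = a * y p

/-- A sequence which between the times `K` and `L` takes values in `[0,1]` and is an orbit
segment. -/
structure IsSlopeSegment (A : Set ℝ) (z : ℤ → ℝ) (K L : ℤ) : Prop where
  le : K ≤ L
  mem_Icc : ∀ p, K ≤ p → p ≤ L → z p ∈ Icc (0 : ℝ) 1
  step : ∀ p, K ≤ p → p < L → ∃ a ∈ A, z (p + 1) = a * z p

/-! ### Gluing, steering and tracing of orbit segments -/

section

variable {A : Set ℝ}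

theorem IsSlopeOrbit.isSlopeSegment {y : ℤ → ℝ} (h : IsSlopeOrbit A y) {K L : ℤ} (hKL : K ≤ L) :
    IsSlopeSegment A y K L :=
  ⟨hKL, fun p _ _ => h.mem_Icc p, fun p _ _ => h.step p⟩

theorem isSlopeOrbit_const (h1 : 1 ∈ A) {c : ℝ} (hc : c ∈ Icc (0 : ℝ) 1) :
    IsSlopeOrbit A fun _ => c :=
  ⟨fun _ => hc, fun _ => ⟨1, h1, (one_mul c).symm⟩⟩

/-- A segment, continued by constants on both sides. -/
theorem IsSlopeSegment.clamp (h1 : 1 ∈ A) {z : ℤ → ℝ} {K L : ℤ} (h : IsSlopeSegment A z K L) :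
    IsSlopeOrbit A fun p => z (max K (min p L)) := by
  have hKL := h.le
  refine ⟨fun p => h.mem_Icc _ (by omega) (by omega), fun p => ?_⟩
  by_cases hp : K ≤ p ∧ p < L
  · obtain ⟨a, ha, hz⟩ := h.step p hp.1 hp.2
    refine ⟨a, ha, ?_⟩
    rwa [show max K (min (p + 1) L) = p + 1 by omega, show max K (min p L) = p by omega]
  · refine ⟨1, h1, ?_⟩
    rw [one_mul, show max K (min (p + 1) L) = max K (min p L) by omega]

theorem IsSlopeOrbit.const_mul {y : ℤ → ℝ} (h : IsSlopeOrbit A y) {c : ℝ} (hc : 0 ≤ c)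
    (hle : ∀ p, c * y p ≤ 1) : IsSlopeOrbit A fun p => c * y p :=
  ⟨fun p => ⟨mul_nonneg hc (h.mem_Icc p).1, hle p⟩, fun p => by
    obtain ⟨a, ha, hy⟩ := h.step p
    exact ⟨a, ha, by rw [hy]; ring⟩⟩

theorem IsSlopeOrbit.piecewise {x y : ℤ → ℝ} (hx : IsSlopeOrbit A x) (hy : IsSlopeOrbit A y)
    {T : ℤ} (hT : x T = y T) : IsSlopeOrbit A fun p => if p ≤ T then x p else y p := by
  refine ⟨fun p => ?_, fun p => ?_⟩
  · split_ifs
    exacts [hx.mem_Icc p, hy.mem_Icc p]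
  · rcases lt_trichotomy p T with h | rfl | h
    · rw [if_pos (by omega), if_pos h.le]
      exact hx.step p
    · rw [if_neg (by omega), if_pos le_rfl, hT]
      exact hy.step p
    · rw [if_neg (by omega), if_neg (by omega)]
      exact hy.step p

/-- Orbits can be steered from `u` to the vicinity of `b` in a prescribed, large time. -/
theorem exists_isSlopeOrbit_connecting (h1 : 1 ∈ A) (h2 : 1 / 2 ∈ A) (h3 : 3 ∈ A) {δ η : ℝ}
    (hδ : 0 < δ) (hη : 0 < η) (hη1 : η < 1) :
    ∃ N : ℕ, ∀ u ∈ Icc δ 1, ∀ b ∈ Icc δ 1, ∀ T S : ℤ, T + N ≤ S →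
      ∃ y, IsSlopeOrbit A y ∧ y T = u ∧ (1 - η) * b ≤ y S ∧ y S ≤ b := by
  obtain ⟨N, hN⟩ := exists_bound_three_pow_div_two_pow hδ hη hη1
  refine ⟨N, fun u hu b hb T S hTS => ?_⟩
  have hu0 : 0 < u := hδ.trans_le hu.1
  have hb0 : 0 < b := hδ.trans_le hb.1
  obtain ⟨p, q, hpq, hlo, hhi⟩ := hN (b / u) ⟨by
      rw [le_div_iff₀ hu0]
      nlinarith [hu.2, hb.1], by
      rw [div_le_iff₀ hu0, ← div_eq_inv_mul, le_div_iff₀ hδ]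
      nlinarith [hu.1, hb.2]⟩
  rw [le_div_iff₀ (by positivity)] at hlo
  have hlo' : (1 - η) * b ≤ u * 3 ^ p / 2 ^ q := by
    rw [le_div_iff₀ (by positivity)]
    calc (1 - η) * b * 2 ^ q = u * ((1 - η) * (b / u) * 2 ^ q) := by field_simp
      _ ≤ u * 3 ^ p := by gcongr
  have hhi' : u * 3 ^ p / 2 ^ q ≤ b := by
    rw [mul_div_assoc]
    calc u * (3 ^ p / 2 ^ q) ≤ u * (b / u) := by gcongr
      _ = b := by field_simp
  -- First `q` halvings, then `p` triplings (the truncated `i - q` is `0` until time `q`), then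
  -- slope `1`. In this order the values never exceed the larger of `u` and the final value, hence
  -- stay at most `1`.
  let w : ℕ → ℝ := fun i => u * 3 ^ (min (i - q) p) / 2 ^ (min i q)
  have hw : IsSlopeSegment A (fun i => w (i - T).toNat) T S := by
    refine ⟨by omega, fun i hi _ => ⟨by positivity, ?_⟩, fun i hi _ => ?_⟩
    · simp only [w]
      set j := (i - T).toNat
      rcases le_total j q with hj | hj
      · rw [show min (j - q) p = 0 by omega, pow_zero, mul_one]
        exact (div_le_self hu0.le (one_le_pow₀ (by norm_num))).trans hu.2
      · rw [min_eq_right hj]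
        refine le_trans ?_ (hhi'.trans hb.2)
        gcongr
        · norm_num
        · exact min_le_right _ _
    · simp only [w]
      rw [show (i + 1 - T).toNat = (i - T).toNat + 1 by omega]
      set j := (i - T).toNat
      rcases lt_or_ge j q with hj | hj
      · refine ⟨1 / 2, h2, ?_⟩
        rw [show min (j + 1 - q) p = 0 by omega, show min (j - q) p = 0 by omega,
          show min (j + 1) q = j + 1 by omega, show min j q = j by omega, pow_succ]
        field_simp
      · rw [show min (j + 1) q = q by omega, show min j q = q by omega]
        rcases lt_or_ge (j - q) p with hj' | hj'
        · refine ⟨3, h3, ?_⟩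
          rw [show min (j + 1 - q) p = j - q + 1 by omega, show min (j - q) p = j - q by omega,
            pow_succ]
          ring
        · refine ⟨1, h1, ?_⟩
          rw [show min (j + 1 - q) p = p by omega, show min (j - q) p = p by omega, one_mul]
  have hwS : w (S - T).toNat = u * 3 ^ p / 2 ^ q := by
    simp only [w]
    rw [show min ((S - T).toNat - q) p = p by omega, show min (S - T).toNat q = q by omega]
  refine ⟨_, hw.clamp h1, ?_, ?_, ?_⟩
  · rw [show (max T (min T S) - T).toNat = 0 by omega]
    simp [w]
  · rwa [show max T (min S S) = S by omega, hwS]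
  · rwa [show max T (min S S) = S by omega, hwS]

/-- A segment can be replaced by an orbit close to it which is not small at its two ends. -/
theorem IsSlopeSegment.exists_isSlopeOrbit_near (h1 : 1 ∈ A) (hA : ∀ a ∈ A, 1 / 3 ≤ a ∧ a ≤ 3)
    {z : ℤ → ℝ} {K L : ℤ} (h : IsSlopeSegment A z K L) {δ : ℝ} (hδ : 0 < δ) (hδ1 : δ ≤ 1) :
    ∃ w, IsSlopeOrbit A w ∧ δ ≤ w K ∧ δ ≤ w L ∧
      ∀ p, K ≤ p → p ≤ L → |w p - z p| ≤ 3 * δ := by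
  by_cases hex : ∃ p, K ≤ p ∧ p ≤ L ∧ δ ≤ z p
  -- `P` and `Q` are the first and last times with value at least `δ`; the segment is frozen outside
  -- `[P, Q]`. There `z` is below `δ`, and the frozen value is below `3 * δ`, being one step of
  -- slope at most `3` after, or at least `1/3` before, a value below `δ`.
  · obtain ⟨P, hP, hPmin⟩ := Int.exists_least_of_bdd (P := fun p => K ≤ p ∧ p ≤ L ∧ δ ≤ z p)
      ⟨K, fun p hp => hp.1⟩ hex
    obtain ⟨Q, hQ, hQmax⟩ := Int.exists_greatest_of_bdd (P := fun p => K ≤ p ∧ p ≤ L ∧ δ ≤ z p)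
      ⟨L, fun p hp => hp.2.1⟩ hex
    have hPQ : P ≤ Q := hPmin Q hQ
    have hseg : IsSlopeSegment A z P Q := ⟨hPQ, fun p hp hp' => h.mem_Icc p (by omega) (by omega),
      fun p hp hp' => h.step p (by omega) (by omega)⟩
    have hKL := h.le
    refine ⟨_, hseg.clamp h1, ?_, ?_, fun p hKp hpL => ?_⟩
    · rw [show max P (min K Q) = P by omega]
      exact hP.2.2
    · rw [show max P (min L Q) = Q by omega]
      exact hQ.2.2
    have hz := h.mem_Icc p hKp hpL
    by_cases hp : p < P
    · rw [show max P (min p Q) = P by omega]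
      have hsmall : z p < δ := not_le.1 fun hge => absurd (hPmin p ⟨hKp, hpL, hge⟩) (by omega)
      have hprev : z (P - 1) < δ :=
        not_le.1 fun hge => absurd (hPmin (P - 1) ⟨by omega, by omega, hge⟩) (by omega)
      have hzP := h.mem_Icc (P - 1) (by omega) (by omega)
      obtain ⟨a, ha, hstep⟩ := h.step (P - 1) (by omega) (by omega)
      rw [sub_add_cancel] at hstep
      have := hP.2.2
      rw [abs_le]
      constructor <;> nlinarith [(hA a ha).2, hz.1, hzP.1]
    by_cases hp' : Q < p
    · rw [show max P (min p Q) = Q by omega]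
      have hsmall : z p < δ := not_le.1 fun hge => absurd (hQmax p ⟨hKp, hpL, hge⟩) (by omega)
      have hnext : z (Q + 1) < δ :=
        not_le.1 fun hge => absurd (hQmax (Q + 1) ⟨by omega, by omega, hge⟩) (by omega)
      obtain ⟨a, ha, hstep⟩ := h.step Q (by omega) (by omega)
      have hzQ := h.mem_Icc Q (by omega) (by omega)
      have := hQ.2.2
      rw [abs_le]
      constructor <;> nlinarith [(hA a ha).1, hz.1, hzQ.1]
    · rw [show max P (min p Q) = p by omega, sub_self, abs_zero]
      positivity
  · push Not at hex
    refine ⟨_, isSlopeOrbit_const h1 ⟨hδ.le, hδ1⟩, le_rfl, le_rfl, fun p hKp hpL => ?_⟩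
    have := hex p hKp hpL
    have := (h.mem_Icc p hKp hpL).1
    rw [abs_le]
    constructor <;> linarith

/-- The inductive step of tracing: follow `x` up to `T`, steer to `c * w K` with `c` slightly below
`1`, and continue along `c * w`, where `w` is an orbit near `z`. The bound `δ` assumed at `T` is
recovered at `L`, so the step can be iterated. -/
theorem exists_isSlopeOrbit_extending (h1 : 1 ∈ A) (h2 : 1 / 2 ∈ A) (h3 : 3 ∈ A)
    (hA : ∀ a ∈ A, 1 / 3 ≤ a ∧ a ≤ 3) {ε : ℝ} (hε : 0 < ε) :
    ∃ δ : ℝ, 0 < δ ∧ δ ≤ 1 ∧ ∃ N : ℕ, ∀ x, IsSlopeOrbit A x → ∀ z K L, IsSlopeSegment A z K L →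
      ∀ T : ℤ, T + N ≤ K → δ ≤ x T →
      ∃ y, IsSlopeOrbit A y ∧ δ ≤ y L ∧ (∀ p ≤ T, y p = x p) ∧
        ∀ p, K ≤ p → p ≤ L → |y p - z p| ≤ ε := by
  -- The error is at most `η` from scaling plus `3 * δ` from replacing `z` by `w`, in all `min 1 ε`.
  -- As `η ≤ 1/2`, scaling leaves at least `δ / 2` of the end value `δ`, whence the threshold `δ /
  -- 2`.
  set η : ℝ := min 1 ε / 2 with hη
  set δ : ℝ := min 1 ε / 6 with hδ
  have hm : 0 < min 1 ε := lt_min one_pos hε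
  have hm1 : min 1 ε ≤ 1 := min_le_left _ _
  have hmε : min 1 ε ≤ ε := min_le_right _ _
  obtain ⟨N, hN⟩ := exists_isSlopeOrbit_connecting h1 h2 h3 (δ := δ / 2) (η := η)
    (by positivity) (by positivity) (by linarith)
  refine ⟨δ / 2, by positivity, by linarith, N, fun x hx z K L hz T hTK hxT => ?_⟩
  obtain ⟨w, hw, hwK, hwL, hwz⟩ := hz.exists_isSlopeOrbit_near h1 hA (δ := δ)
    (by positivity) (by linarith)
  have hδ0 : 0 < δ := by positivity
  have hwK0 : 0 < w K := hδ0.trans_le hwK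
  obtain ⟨v, hv, hvT, hvlo, hvhi⟩ := hN (x T) ⟨hxT, (hx.mem_Icc T).2⟩ (w K)
    ⟨by linarith, (hw.mem_Icc K).2⟩ T K hTK
  set c := v K / w K with hc
  have hc0 : 1 - η ≤ c := (le_div_iff₀ hwK0).2 hvlo
  have hc1 : c ≤ 1 := (div_le_one hwK0).2 hvhi
  have hcpos : 0 ≤ c := by linarith
  have hcw : IsSlopeOrbit A fun p => c * w p :=
    hw.const_mul hcpos fun p => mul_le_one₀ hc1 (hw.mem_Icc p).1 (hw.mem_Icc p).2
  have hvc : v K = c * w K := (div_mul_cancel₀ _ hwK0.ne').symm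
  have hKL := hz.le
  have hval : ∀ p, K ≤ p → (if p ≤ K then v p else c * w p) = c * w p := by
    intro p hp
    split_ifs with hpK
    · rw [le_antisymm hpK hp, hvc]
    · rfl
  have hval' : ∀ p, K ≤ p →
      (if p ≤ T then x p else if p ≤ K then v p else c * w p) = c * w p := by
    intro p hp
    split_ifs with hpT hpK
    -- Possible only if `N = 0`; then all three pieces meet at `T = K`.
    · have hpK : p = K := by omega
      have hTK' : T = K := by omega
      rw [hpK, ← hvc, ← hTK', hvT]
    · rw [le_antisymm hpK hp, hvc]
    · rfl
  refine ⟨_, hx.piecewise (hv.piecewise hcw hvc) (T := T) ?_, ?_, ?_, ?_⟩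
  · rw [if_pos (by omega), hvT]
  · rw [hval' L hKL]
    nlinarith
  · intro p hp
    exact if_pos hp
  · intro p hKp hpL
    rw [hval' p hKp]
    have hwp := hw.mem_Icc p
    have hd := abs_le.1 (hwz p hKp hpL)
    rw [abs_le]
    constructor <;> nlinarith [hwp.1, hwp.2, hd.1, hd.2]

/-- Finitely many orbit segments, separated by long gaps, are traced by a single orbit. -/
theorem exists_isSlopeOrbit_tracing (h1 : 1 ∈ A) (h2 : 1 / 2 ∈ A) (h3 : 3 ∈ A)
    (hA : ∀ a ∈ A, 1 / 3 ≤ a ∧ a ≤ 3) {ε : ℝ} (hε : 0 < ε) :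
    ∃ N : ℕ, ∀ (n : ℕ) (z : ℕ → ℤ → ℝ) (K L : ℕ → ℤ),
      (∀ j < n, IsSlopeSegment A (z j) (K j) (L j)) →
      (∀ j, j + 1 < n → L j + N ≤ K (j + 1)) →
      ∃ y, IsSlopeOrbit A y ∧ ∀ j < n, ∀ p, K j ≤ p → p ≤ L j → |y p - z j p| ≤ ε := by
  obtain ⟨δ, hδ, hδ1, N, hN⟩ := exists_isSlopeOrbit_extending h1 h2 h3 hA hε
  refine ⟨N, fun n z K L hz hKL => ?_⟩
  -- Invariant: at a time `T` after all segments traced so far the orbit is not small. Changing it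
  -- after `T` spoils nothing, and it can be steered from there.
  have key : ∀ m ≤ n, ∃ y, IsSlopeOrbit A y ∧ ∃ T, δ ≤ y T ∧ (m < n → T + N ≤ K m) ∧
      ∀ j < m, L j ≤ T ∧ ∀ p, K j ≤ p → p ≤ L j → |y p - z j p| ≤ ε := by
    intro m
    induction m with
    | zero =>
      exact fun _ => ⟨_, isSlopeOrbit_const h1 ⟨zero_le_one, le_rfl⟩, K 0 - N, hδ1,
        fun _ => by omega, fun j hj => absurd hj (Nat.not_lt_zero j)⟩
    | succ m ih =>
      intro hm
      obtain ⟨x, hx, T, hxT, hTK, htr⟩ := ih (by omega)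
      obtain ⟨y, hy, hyL, hyx, hyz⟩ := hN x hx _ _ _ (hz m (by omega)) T (hTK (by omega)) hxT
      refine ⟨y, hy, L m, hyL, hKL m, fun j hj => ?_⟩
      rcases Nat.lt_succ_iff_lt_or_eq.1 hj with hj | rfl
      · have hle := (hz m (by omega)).le
        have := hTK (by omega)
        have := (htr j hj).1
        refine ⟨by omega, fun p hKp hpL => ?_⟩
        rw [hyx p (by omega)]
        exact (htr j hj).2 p hKp hpL
      · exact ⟨le_rfl, hyz⟩
  obtain ⟨y, hy, T, -, -, htr⟩ := key n le_rfl
  exact ⟨y, hy, fun j hj => (htr j hj).2⟩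

/-- Every segment is approximated by an orbit that attains the value `1` after its start. -/
theorem IsSlopeSegment.exists_isSlopeOrbit_eq_one (h1 : 1 ∈ A) (h2 : 1 / 2 ∈ A) (h3 : 3 ∈ A)
    (hA : ∀ a ∈ A, 1 / 3 ≤ a ∧ a ≤ 3) {z : ℤ → ℝ} {K L : ℤ} (h : IsSlopeSegment A z K L)
    {ε : ℝ} (hε : 0 < ε) :
    ∃ y, IsSlopeOrbit A y ∧ (∃ p, K ≤ p ∧ y p = 1) ∧ ∀ p, K ≤ p → p ≤ L → |y p - z p| ≤ ε := by
  have hm : 0 < min 1 ε / 2 := half_pos (lt_min one_pos hε)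
  have hm1 : min 1 ε ≤ 1 := min_le_left _ _
  have hmε : min 1 ε ≤ ε := min_le_right _ _
  obtain ⟨N, hN⟩ := exists_isSlopeOrbit_tracing h1 h2 h3 hA hm
  have hKL := h.le
  -- The second segment to be traced is the value `1` at the single time `L + N`.
  obtain ⟨x, hx, hxz⟩ := hN 2 (fun j => if j = 0 then z else fun _ => 1)
    (fun j => if j = 0 then K else L + N) (fun j => if j = 0 then L else L + N) (by
      intro j _
      by_cases hj : j = 0
      · simpa [hj] using h
      · simpa [hj] using
          (isSlopeOrbit_const h1 ⟨zero_le_one, le_rfl⟩).isSlopeSegment (le_refl (L + N))) (by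
      intro j hj
      rw [if_pos (by omega), if_neg (by omega)])
  have hxz0 := hxz 0 (by norm_num)
  have hxz1 := hxz 1 (by norm_num) (L + N)
  simp only [if_true, one_ne_zero, if_false, le_refl, forall_const] at hxz0 hxz1
  -- Dividing by the maximum `M ≥ 1 - min 1 ε / 2` creates the value `1` and adds an error of at
  -- most `min 1 ε / 2`. Outside the window `x` may exceed `M`, so the orbit is clamped to the
  -- window.
  obtain ⟨q, hq, hmax⟩ := (Finset.Icc K (L + N)).exists_max_image x
    ⟨K, Finset.mem_Icc.2 ⟨le_rfl, by omega⟩⟩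
  rw [Finset.mem_Icc] at hq
  set M := x q with hM
  have hM1 : M ≤ 1 := (hx.mem_Icc q).2
  have hMlo : 1 - min 1 ε / 2 ≤ M := by
    have := hmax (L + N) (Finset.mem_Icc.2 ⟨by omega, le_rfl⟩)
    linarith [(abs_le.1 hxz1).1]
  have hM0 : 0 < M := by linarith
  have hle : ∀ p, K ≤ p → p ≤ L + N → M⁻¹ * x p ≤ 1 := by
    intro p hp hp'
    rw [inv_mul_le_iff₀ hM0, mul_one]
    exact hmax p (Finset.mem_Icc.2 ⟨hp, hp'⟩)
  refine ⟨_, ((hx.isSlopeSegment (show K ≤ L + N by omega)).clamp h1).const_mul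
    (inv_nonneg.2 hM0.le) fun p => hle _ (by omega) (by omega), ⟨q, hq.1, ?_⟩, fun p hp hp' => ?_⟩
  · rw [show max K (min q (L + N)) = q by omega]
    exact inv_mul_cancel₀ hM0.ne'
  · rw [show max K (min p (L + N)) = p by omega]
    have hp1 := hle p hp (by omega)
    have hd := abs_le.1 (hxz0 p hp hp')
    have hp0 : 0 ≤ M⁻¹ * x p := mul_nonneg (inv_nonneg.2 hM0.le) (hx.mem_Icc p).1
    have hxp : x p = M * (M⁻¹ * x p) := by field_simp
    generalize M⁻¹ * x p = s at hp1 hp0 hxp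
    rw [abs_le]
    constructor <;> nlinarith [hd.1, hd.2]

end

/-- A presentation of a metric space `X` as a Mahavier product of the relation `F_A` over an index
set `ι`, which is identified by `idx` and `val` with an interval of integers unbounded above and
containing `0`; the integers from `lo n` on belong to that interval. -/
structure ProductModel (A : Set ℝ) (X : Type*) [MetricSpace X] (ι : Type*) where
  succ : ι → ι
  idx : ℤ → ι
  val : ι → ℤ
  weight : ι → ℕ
  lo : ℕ → ℤ
  lo_nonpos : ∀ n, lo n ≤ 0
  idx_val : ∀ i, idx (val i) = i
  val_succ : ∀ i, val (succ i) = val i + 1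
  idx_succ : ∀ n p, lo n ≤ p → idx (p + 1) = succ (idx p)
  val_idx : ∀ n p, lo n ≤ p → val (idx p) = p
  val_mem : ∀ n i, weight i ≤ n → lo n ≤ val i ∧ val i ≤ n
  succ_induction : ∀ P : ι → Prop, P (idx 0) → (∀ i, P i → P (succ i)) →
    (∀ i, P (succ i) → P i) → ∀ i, P i
  coord : X → ι → unitInterval
  rel : ∀ x i, (coord x i, coord x (succ i)) ∈ slopeRelation A
  ofSeq : ∀ c : ι → unitInterval, (∀ i, (c i, c (succ i)) ∈ slopeRelation A) → X
  coord_ofSeq : ∀ c h, coord (ofSeq c h) = c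
  isEmbedding : IsEmbedding coord
  dist_eq : ∀ x y, dist x y = weightedDist weight (coord x) (coord y)

theorem isClosed_slopeRelation {A : Set ℝ} (hA : A.Finite) : IsClosed (slopeRelation A) := by
  have h : slopeRelation A =
      ⋃ a ∈ A, {p : unitInterval × unitInterval | (p.2 : ℝ) = a * (p.1 : ℝ)} := by
    ext p
    simp [slopeRelation]
  rw [h]
  exact hA.isClosed_biUnion fun a _ => isClosed_eq (by fun_prop) (by fun_prop)

/-! ### Mahavier products as cones over spaces of slope sequences -/

namespace ProductModel

variable {A : Set ℝ} {X : Type*} [MetricSpace X] {ι : Type*} (M : ProductModel A X ι)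

theorem exists_coord_succ (x : X) (i : ι) :
    ∃ a ∈ A, (M.coord x (M.succ i) : ℝ) = a * M.coord x i := M.rel x i

theorem coord_ext {x y : X} (h : ∀ i, M.coord x i = M.coord y i) : x = y :=
  M.isEmbedding.injective (funext h)

theorem dist_le_of_forall_abs_sub_le {x y : X} {ε : ℝ} {n : ℕ} (hn : (1 / 2 : ℝ) ^ n ≤ ε)
    (h : ∀ i, M.weight i ≤ n → |(M.coord x i : ℝ) - M.coord y i| ≤ ε) : dist x y ≤ ε := by
  rw [M.dist_eq]
  refine Real.iSup_le (fun i => ?_) (le_trans (by positivity) hn)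
  by_cases hi : M.weight i ≤ n
  · exact (div_le_self (abs_nonneg _) (one_le_pow₀ (by norm_num))).trans (h i hi)
  · refine (weightedDist_term_le _ _ _ i).trans (le_trans ?_ hn)
    rw [one_div_pow]
    push Not at hi
    gcongr
    norm_num

theorem dist_le_dist_of_forall_coord {x y x' y' : X}
    (h : ∀ i, |(M.coord x i : ℝ) - M.coord y i| ≤ |(M.coord x' i : ℝ) - M.coord y' i|) :
    dist x y ≤ dist x' y' := by
  rw [M.dist_eq, M.dist_eq]
  refine Real.iSup_le (fun i => ?_) (weightedDist_nonneg _ _ _)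
  exact (div_le_div_of_nonneg_right (h i) (by positivity)).trans (le_weightedDist _ _ _ i)

theorem compactSpace (M : ProductModel A X ι) (hA : A.Finite) : CompactSpace X := by
  have hrange : range M.coord = {c | ∀ i, (c i, c (M.succ i)) ∈ slopeRelation A} := by
    ext c
    constructor
    · rintro ⟨x, rfl⟩
      exact M.rel x
    · exact fun h => ⟨M.ofSeq c h, M.coord_ofSeq c h⟩
  have hclosed : IsClosed (range M.coord) := by
    rw [hrange, ofPred_forall]
    exact isClosed_iInter fun i => (isClosed_slopeRelation hA).preimage
      (f := fun c : ι → unitInterval => (c i, c (M.succ i))) (by fun_prop)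
  exact IsClosedEmbedding.compactSpace ⟨M.isEmbedding, hclosed⟩

/-- Multiplication of all coordinates by a number. -/
noncomputable def scale (t : unitInterval) (x : X) : X :=
  M.ofSeq (fun i => t * M.coord x i) fun i => by
    obtain ⟨a, ha, h⟩ := M.exists_coord_succ x i
    exact ⟨a, ha, by simp only [Set.Icc.coe_mul, h]; ring⟩

theorem coord_scale (t : unitInterval) (x : X) (i : ι) :
    (M.coord (M.scale t x) i : ℝ) = t * M.coord x i := by
  rw [scale, M.coord_ofSeq, Set.Icc.coe_mul]

/-- The point all of whose coordinates are `0`. -/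
noncomputable def zero (h1 : 1 ∈ A) : X := M.ofSeq (fun _ => 0) fun _ => ⟨1, h1, by simp⟩

theorem coord_zero (h1 : 1 ∈ A) (i : ι) : M.coord (M.zero h1) i = 0 :=
  congrFun (M.coord_ofSeq _ _) i

/-- The sequence of quotients of consecutive coordinates. -/
noncomputable def ratio (x : X) (i : ι) : ↥(insert 0 A) :=
  ⟨(M.coord x (M.succ i) : ℝ) / M.coord x i, by
    obtain ⟨a, ha, h⟩ := M.exists_coord_succ x i
    -- Division by `0` gives `0`; hence the value `0` adjoined to `A`.
    by_cases h0 : (M.coord x i : ℝ) = 0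
    · simp [h0]
    · rw [h, mul_div_cancel_right₀ _ h0]
      exact mem_insert_of_mem _ ha⟩

/-- Positive slopes propagate vanishing forwards and backwards. Hence away from the zero sequence
the ratios are genuine slopes and vary continuously. -/
theorem coord_eq_zero_iff (hpos : ∀ a ∈ A, 0 < a) (x : X) (i : ι) :
    (M.coord x i : ℝ) = 0 ↔ (M.coord x (M.idx 0) : ℝ) = 0 := by
  refine M.succ_induction (fun i => (M.coord x i : ℝ) = 0 ↔ (M.coord x (M.idx 0) : ℝ) = 0) Iff.rfl
    ?_ ?_ i
  all_goals
    intro i h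
    obtain ⟨a, ha, hi⟩ := M.exists_coord_succ x i
    have := (hpos a ha).ne'
    simpa [hi, this] using h

theorem coord_ne_zero (hpos : ∀ a ∈ A, 0 < a) (h1 : 1 ∈ A) {x : X} (hx : x ≠ M.zero h1) (i : ι) :
    (M.coord x i : ℝ) ≠ 0 := by
  contrapose hx
  rw [M.coord_eq_zero_iff hpos] at hx
  refine M.coord_ext fun j => Subtype.ext ?_
  rw [(M.coord_eq_zero_iff hpos x j).2 hx, M.coord_zero]
  rfl

theorem eq_of_ratio_eq (hpos : ∀ a ∈ A, 0 < a) (h1 : 1 ∈ A) {x y : X}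
    (h0 : (M.coord x (M.idx 0) : ℝ) = M.coord y (M.idx 0)) (hr : M.ratio x = M.ratio y) :
    x = y := by
  by_cases hx : x = M.zero h1
  · by_contra hy
    refine M.coord_ne_zero hpos h1 (fun h => hy (hx.trans h.symm)) (M.idx 0) ?_
    rw [← h0, hx, M.coord_zero]
    rfl
  have hx0 := M.coord_ne_zero hpos h1 hx
  have hy0 : ∀ i, (M.coord y i : ℝ) ≠ 0 := fun i hi =>
    hx0 (M.idx 0) (h0.trans ((M.coord_eq_zero_iff hpos y i).1 hi))
  have hr' : ∀ i, (M.coord x (M.succ i) : ℝ) / M.coord x i =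
      (M.coord y (M.succ i) : ℝ) / M.coord y i := fun i => congrArg Subtype.val (congrFun hr i)
  refine M.coord_ext fun i => Subtype.ext ?_
  refine M.succ_induction (fun i => (M.coord x i : ℝ) = M.coord y i) h0 (fun i hi => ?_)
    (fun i hi => ?_) i
  · have := hr' i
    rwa [hi, div_left_inj' (hy0 i)] at this
  · have := hr' i
    rw [hi, div_eq_div_iff (hx0 i) (hy0 i)] at this
    exact (mul_left_cancel₀ (hy0 _) this).symm

theorem continuous_coord (i : ι) : Continuous fun x => (M.coord x i : ℝ) :=
  continuous_subtype_val.comp ((continuous_apply i).comp M.isEmbedding.continuous)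

theorem continuousOn_ratio (hpos : ∀ a ∈ A, 0 < a) (h1 : 1 ∈ A) :
    ContinuousOn M.ratio {M.zero h1}ᶜ := by
  refine continuousOn_pi.2 fun i => IsInducing.subtypeVal.continuousOn_iff.2 ?_
  exact (M.continuous_coord _).continuousOn.div (M.continuous_coord _).continuousOn
    fun x hx => M.coord_ne_zero hpos h1 hx i

/-- The fan chart of a Mahavier product. -/
noncomputable def fanChart (hpos : ∀ a ∈ A, 0 < a) (h1 : 1 ∈ A) :
    FanChart X (ι → ↥(insert 0 A)) where
  top := M.zero h1
  height x := M.coord x (M.idx 0)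
  dir := M.ratio
  scale := M.scale
  continuous_height := M.continuous_coord _
  height_nonneg x := (M.coord x (M.idx 0)).2.1
  height_eq_zero_iff x := ⟨fun h => by
    by_contra hx
    exact M.coord_ne_zero hpos h1 hx _ h, fun h => by simp [h, M.coord_zero]⟩
  continuousOn_dir := M.continuousOn_ratio hpos h1
  ext _ _ := M.eq_of_ratio_eq hpos h1
  height_scale t x := M.coord_scale t x _
  dir_scale t x ht := by
    have ht' : (t : ℝ) ≠ 0 := fun h => ht (Subtype.ext h)
    funext i
    refine Subtype.ext ?_
    simp only [ratio, coord_scale]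
    exact mul_div_mul_left _ _ ht'
  continuous_scale x := by
    rw [M.isEmbedding.continuous_iff]
    refine continuous_pi fun i => continuous_induced_rng.2 ?_
    have h : (Subtype.val ∘ fun t => M.coord (M.scale t x) i) =
        fun t : unitInterval => (t : ℝ) * M.coord x i := funext fun t => M.coord_scale t x i
    exact (continuous_subtype_val.mul continuous_const).congr fun t => (congrFun h t).symm
  dist_scale_le t x y := by
    refine M.dist_le_dist_of_forall_coord fun i => ?_
    rw [M.coord_scale, M.coord_scale, ← mul_sub, abs_mul, abs_of_nonneg t.2.1]
    exact mul_le_of_le_one_left (abs_nonneg _) t.2.2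

/-- The point given by a bi-infinite orbit. -/
noncomputable def ofOrbit (y : ℤ → ℝ) (hy : IsSlopeOrbit A y) : X :=
  M.ofSeq (fun i => ⟨y (M.val i), hy.mem_Icc _⟩) fun i => by
    obtain ⟨a, ha, h⟩ := hy.step (M.val i)
    exact ⟨a, ha, by rw [M.val_succ]; exact h⟩

theorem coord_ofOrbit {y : ℤ → ℝ} (hy : IsSlopeOrbit A y) (i : ι) :
    (M.coord (M.ofOrbit y hy) i : ℝ) = y (M.val i) := by
  rw [ofOrbit, M.coord_ofSeq]

theorem isSlopeSegment_coord (x : X) (n : ℕ) {K L : ℤ} (hK : M.lo n ≤ K) (hKL : K ≤ L) :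
    IsSlopeSegment A (fun p => (M.coord x (M.idx p) : ℝ)) K L :=
  ⟨hKL, fun p _ _ => (M.coord x (M.idx p)).2, fun p hp _ => by
    obtain ⟨a, ha, h⟩ := M.exists_coord_succ x (M.idx p)
    exact ⟨a, ha, by rw [M.idx_succ n p (hK.trans hp)]; exact h⟩⟩

/-- If `e` is `t` times `y`, the coordinate `1` of `e` forces `t = 1`, so nothing lies above `e` on
its leg. -/
theorem isDendroidEndpoint_of_coord_eq_one (hA : A.Finite) (hpos : ∀ a ∈ A, 0 < a) (h1 : 1 ∈ A)
    {e : X} {i : ι} (he : (M.coord e i : ℝ) = 1) : IsDendroidEndpoint e := by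
  have : Finite ↥(insert 0 A) := hA.insert 0
  refine (M.fanChart hpos h1).isDendroidEndpoint (fun h => ?_) ?_
  · rw [h] at he
    exact zero_ne_one ((congrArg Subtype.val (M.coord_zero h1 i)).symm.trans he)
  · rintro y ⟨t, rfl⟩
    have hty : (t : ℝ) * M.coord y i = 1 := (M.coord_scale t y i).symm.trans he
    have ht : t = 1 := Subtype.ext (le_antisymm t.2.2 (by
      have := mul_le_of_le_one_right t.2.1 (M.coord y i).2.2
      change (1 : ℝ) ≤ t
      linarith))
    rw [ht]
    exact ((M.fanChart hpos h1).scale_one y).symm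

theorem dense_endpoints (M : ProductModel A X ι) (hA : A.Finite) (h1 : 1 ∈ A) (h2 : 1 / 2 ∈ A)
    (h3 : 3 ∈ A) (hbd : ∀ a ∈ A, 1 / 3 ≤ a ∧ a ≤ 3) : Dense {e : X | IsDendroidEndpoint e} := by
  have hpos : ∀ a ∈ A, 0 < a := fun a ha => by linarith [(hbd a ha).1]
  intro x
  rw [Metric.mem_closure_iff]
  intro ε hε
  obtain ⟨n, hn⟩ := exists_pow_lt_of_lt_one (half_pos hε) (by norm_num : (1 / 2 : ℝ) < 1)
  -- Attaining `1` at a time `p ≥ lo n` matters: only then is `p` the position of an actual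
  -- coordinate.
  obtain ⟨y, hy, ⟨p, hp, hyp⟩, hyx⟩ := (M.isSlopeSegment_coord x n le_rfl
    ((M.lo_nonpos n).trans (Nat.cast_nonneg n))).exists_isSlopeOrbit_eq_one h1 h2 h3 hbd
    (half_pos hε)
  refine ⟨M.ofOrbit y hy, M.isDendroidEndpoint_of_coord_eq_one hA hpos h1 (i := M.idx p) ?_, ?_⟩
  · rw [M.coord_ofOrbit, M.val_idx n p hp, hyp]
  · refine (M.dist_le_of_forall_abs_sub_le hn.le fun i hi => ?_).trans_lt (half_lt_self hε)
    obtain ⟨hlo, hhi⟩ := M.val_mem n i hi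
    have := hyx _ hlo hhi
    rwa [M.idx_val, abs_sub_comm, ← M.coord_ofOrbit hy] at this

theorem isLelekFan (M : ProductModel A X ι) (hA : A.Finite) (h1 : 1 ∈ A) (h2 : 1 / 2 ∈ A)
    (h3 : 3 ∈ A) (hbd : ∀ a ∈ A, 1 / 3 ≤ a ∧ a ≤ 3) : IsLelekFan X := by
  have hpos : ∀ a ∈ A, 0 < a := fun a ha => by linarith [(hbd a ha).1]
  have : Finite ↥(insert 0 A) := hA.insert 0
  have : CompactSpace X := M.compactSpace hA
  have hstep : ∀ c ∈ Icc (0 : ℝ) 1, ∀ a ∈ A, a * c ≤ 1 →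
      IsSlopeOrbit A fun p : ℤ => if p ≤ 0 then c else a * c := by
    intro c hc a ha hac
    refine ⟨fun p => ?_, fun p => ?_⟩
    · split_ifs
      exacts [hc, ⟨mul_nonneg (hpos a ha).le hc.1, hac⟩]
    · rcases lt_trichotomy p 0 with h | rfl | h
      · exact ⟨1, h1, by rw [if_pos (by omega), if_pos h.le, one_mul]⟩
      · exact ⟨a, ha, by rw [if_neg (by omega), if_pos le_rfl]⟩
      · exact ⟨1, h1, by rw [if_neg (by omega), if_neg (by omega), one_mul]⟩
  -- Three points with different ratios at position `0` give the three legs at the vertex. The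
  -- common value `1/3` there leaves room for the slope `3`.
  let s : Fin 3 → ℝ := ![1, 1 / 2, 3]
  have hsA : ∀ k, s k ∈ A := by
    intro k
    fin_cases k
    exacts [h1, h2, h3]
  have hs : ∀ k, s k * (1 / 3) ≤ 1 := fun k => by linarith [(hbd _ (hsA k)).2]
  have hsinj : Function.Injective s := by
    intro i j h
    fin_cases i <;> fin_cases j <;> first | rfl | (norm_num [s] at h)
  have horb := fun k => hstep (1 / 3) ⟨by norm_num, by norm_num⟩ (s k) (hsA k) (hs k)
  let e : Fin 3 → X := fun k => M.ofOrbit _ (horb k)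
  have hval0 : M.val (M.idx 0) = 0 := M.val_idx 0 0 (M.lo_nonpos 0)
  have he0 : ∀ k, (M.coord (e k) (M.idx 0) : ℝ) = 1 / 3 := fun k => by
    rw [M.coord_ofOrbit, hval0, if_pos le_rfl]
  have he1 : ∀ k, (M.coord (e k) (M.succ (M.idx 0)) : ℝ) = s k * (1 / 3) := fun k => by
    rw [M.coord_ofOrbit, M.val_succ, hval0, if_neg (by norm_num)]
  refine ⟨_, (M.fanChart hpos h1).isSmoothFanWithTop e (fun k h => ?_) (fun i j h => ?_),
    M.dense_endpoints hA h1 h2 h3 hbd⟩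
  · have h0 := he0 k
    rw [h] at h0
    have := (congrArg Subtype.val (M.coord_zero h1 (M.idx 0))).symm.trans h0
    norm_num at this
  · have h' : (M.coord (e i) (M.succ (M.idx 0)) : ℝ) / M.coord (e i) (M.idx 0) =
        (M.coord (e j) (M.succ (M.idx 0)) : ℝ) / M.coord (e j) (M.idx 0) :=
      congrArg Subtype.val (congrFun h (M.idx 0))
    rw [he0, he0, he1, he1] at h'
    exact hsinj (by linarith)

/-! ### Continuity and specification of the shift -/

section Shift

variable {f : X → X}

theorem coord_iterate (hf : ∀ x i, M.coord (f x) i = M.coord x (M.succ i)) (j : ℕ) (x : X)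
    (i : ι) : M.coord (f^[j] x) i = M.coord x (M.succ^[j] i) := by
  induction j generalizing i with
  | zero => rfl
  | succ j ih => rw [Function.iterate_succ_apply', hf, ih, ← Function.iterate_succ_apply]

theorem val_iterate_succ (j : ℕ) (i : ι) : M.val (M.succ^[j] i) = M.val i + j := by
  induction j with
  | zero => simp
  | succ j ih =>
    rw [Function.iterate_succ_apply', M.val_succ, ih]
    push_cast
    ring

theorem continuous_shift (hf : ∀ x i, M.coord (f x) i = M.coord x (M.succ i)) : Continuous f := by
  rw [M.isEmbedding.continuous_iff]
  refine continuous_pi fun i => ?_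
  simp only [Function.comp_apply, hf]
  exact (continuous_apply _).comp M.isEmbedding.continuous

theorem hasSpecificationProperty (hf : ∀ x i, M.coord (f x) i = M.coord x (M.succ i))
    (h1 : 1 ∈ A) (h2 : 1 / 2 ∈ A) (h3 : 3 ∈ A) (hbd : ∀ a ∈ A, 1 / 3 ≤ a ∧ a ≤ 3) :
    HasSpecificationProperty f := by
  intro ε hε
  obtain ⟨n, hn⟩ := exists_pow_lt_of_lt_one hε (by norm_num : (1 / 2 : ℝ) < 1)
  obtain ⟨N, hN⟩ := exists_isSlopeOrbit_tracing h1 h2 h3 hbd hε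
  have hlo := M.lo_nonpos n
  -- Up to `ε`, a distance at time `j` depends only on positions from `j + lo n` to `j + n`. The
  -- time windows are enlarged accordingly, and the required gap grows by `n - lo n`; the final `1`
  -- ensures positivity.
  refine ⟨N + n + (-M.lo n).toNat + 1, by omega, fun S hS => ?_⟩
  have hpos := S.n_pos
  -- Extends the finite family to all of `ℕ`, as the tracing lemma requires; values beyond `S.n`
  -- play no role.
  let r : ℕ → Fin S.n := fun j => ⟨min j (S.n - 1), by omega⟩
  have hr : ∀ j (hj : j < S.n), r j = ⟨j, hj⟩ := fun j hj =>
    Fin.ext (min_eq_left (by omega))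
  obtain ⟨y, hy, hyz⟩ := hN S.n (fun j p => (M.coord (S.x (r j)) (M.idx p) : ℝ))
    (fun j => S.k (r j) + M.lo n) (fun j => S.l (r j) + n)
    (fun j _ => M.isSlopeSegment_coord _ n (by omega) (by have := S.k_le_l (r j); omega))
    (fun j hj => by
      have := hS j hj
      rw [hr j (by omega), hr (j + 1) hj]
      omega)
  refine ⟨M.ofOrbit y hy, fun a j hkj hjl => M.dist_le_of_forall_abs_sub_le hn.le fun i hi => ?_⟩
  obtain ⟨hvlo, hvhi⟩ := M.val_mem n i hi
  have hv := M.val_iterate_succ j i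
  have hra : r a = a := hr a a.2
  have := hyz a a.2 (M.val (M.succ^[j] i)) (by rw [hra]; omega) (by rw [hra]; omega)
  rw [M.idx_val, hra, ← M.coord_ofOrbit hy] at this
  rwa [M.coord_iterate hf, M.coord_iterate hf]

end Shift

end ProductModel

/-- The one-sided Mahavier product of `F_A`. -/
noncomputable def oneSidedModel (A : Set ℝ) :
    ProductModel A (OneSidedProduct (slopeRelation A)) ℕ where
  succ i := i + 1
  idx := Int.toNat
  val i := i
  weight i := i + 1
  lo _ := 0
  lo_nonpos _ := le_rfl
  idx_val _ := Int.toNat_natCast _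
  val_succ _ := Nat.cast_succ _
  idx_succ _ p hp := by omega
  val_idx _ _ hp := Int.toNat_of_nonneg hp
  val_mem n i hi := by omega
  succ_induction P h0 hs _ i := Nat.rec h0 hs i
  coord := OneSidedProduct.coord
  rel := OneSidedProduct.rel
  ofSeq := OneSidedProduct.mk
  coord_ofSeq _ _ := rfl
  isEmbedding := ⟨⟨rfl⟩, fun _ _ => OneSidedProduct.ext⟩
  dist_eq _ _ := rfl

/-- The two-sided Mahavier product of `F_A`. -/
noncomputable def twoSidedModel (A : Set ℝ) :
    ProductModel A (TwoSidedProduct (slopeRelation A)) ℤ where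
  succ i := i + 1
  idx i := i
  val i := i
  weight := Int.natAbs
  lo n := -n
  lo_nonpos _ := by omega
  idx_val _ := rfl
  val_succ _ := rfl
  idx_succ _ _ _ := rfl
  val_idx _ _ _ := rfl
  val_mem n i hi := by omega
  succ_induction P h0 hs hp i := Int.induction_on i h0 (fun i => hs i) fun i hi =>
    hp _ (by rwa [sub_add_cancel])
  coord := TwoSidedProduct.coord
  rel := TwoSidedProduct.rel
  ofSeq := TwoSidedProduct.mk
  coord_ofSeq _ _ := rfl
  isEmbedding := ⟨⟨rfl⟩, fun _ _ => TwoSidedProduct.ext⟩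
  dist_eq _ _ := rfl

theorem mainTheorem1 (G : Set (unitInterval × unitInterval)) (hG : G ∈ slopeRelationFamily) :
    IsLelekFan (OneSidedProduct G) ∧ IsLelekFan (TwoSidedProduct G) ∧
      (Continuous (oneSidedShift G) ∧ HasSpecificationProperty (oneSidedShift G)) ∧
      (Continuous (twoSidedShift G) ∧ HasSpecificationProperty (twoSidedShift G)) := by
  obtain ⟨A, ⟨hA, h3, h1, h2, hbd⟩, rfl⟩ := hG
  have hσ : ∀ x i, (oneSidedModel A).coord (oneSidedShift _ x) i =
      (oneSidedModel A).coord x ((oneSidedModel A).succ i) := fun _ _ => rfl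
  have hτ : ∀ x i, (twoSidedModel A).coord (twoSidedShift _ x) i =
      (twoSidedModel A).coord x ((twoSidedModel A).succ i) := fun _ _ => rfl
  exact ⟨(oneSidedModel A).isLelekFan hA h1 h2 h3 hbd, (twoSidedModel A).isLelekFan hA h1 h2 h3 hbd,
    ⟨(oneSidedModel A).continuous_shift hσ,
      (oneSidedModel A).hasSpecificationProperty hσ h1 h2 h3 hbd⟩,
    (twoSidedModel A).continuous_shift hτ,
    (twoSidedModel A).hasSpecificationProperty hτ h1 h2 h3 hbd⟩
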